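/- **Definitions.** A *metric measure space* $(X,d_X,\mu)$ is a separable metric space $(X,d_X)$ with a nonzero Borel regular measure $\mu$ that is finite on bounded sets. The measure $\mu$ is *Radon* if $\mu(K)<\infty$ for every compact set $K\subset X$ and $\mu(A)=\sup\{\mu(K)\mid K\subset A \text{ compact}\}$ for every $\mu$-measurable set $A$. For $1\le p<\infty$, a Borel function $g\colon X\to[0,\infty]$ is a *$p$-weak upper gradient* of $u\colon X\to\mathbb R$ if $|u(\gamma(0))-u(\gamma(L))|\le\int_\gamma g\,ds$ for all compact rectifiable curves $\gamma$, parametrized by arc length on $[0,L]$, outside a family of $p$-modulus zero; here the $p$-modulus of a family $\Gamma$ of curves is the infimum of $\int_X\rho^p\,d\mu$ over all Borel functions $\rho\colon X\to[0,\infty]$ with $\int_\gamma\rho\,ds\ge1$ for every $\gamma\in\Gamma$. The space $D^{1,p}(X)$ consists of the $\mu$-measurable functions with a $p$-integrable $p$-weak upper gradient, and $|\nabla_p u|$ denotes the minimal $p$-weak upper gradient of $u$, that is, the $\mu$-a.e. smallest among its locally $p$-integrable $p$-weak upper gradients. $\operatorname{Lip}(Y)$ is the set of all Lipschitz functions $Y\to\mathbb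 R$. **Theorem.** Let $(X,d_X,\mu)$ and $(Y,d_Y,\nu)$ be metric measure spaces, where $\mu$ is a Radon measure, let $1\le q<p<\infty$ and $\frac1\sigma=\frac1q-\frac1p$. Let $\varphi\colon X\to Y$ be a continuous mapping that induces the bounded composition operator $$\varphi^*\colon D^{1,p}(Y)\cap\operatorname{Lip}(Y)\to D^{1,q}(X),\qquad \varphi^*u=u\circ\varphi,$$ that is, there is a constant $C<\infty$ such that every $u\in D^{1,p}(Y)\cap\operatorname{Lip}(Y)$ satisfies $u\circ\varphi\in D^{1,q}(X)$ and $$\Big(\int_X|\nabla_q(u\circ\varphi)|^q\,d\mu\Big)^{1/q}\le C\Big(\int_Y|\nabla_pu|^p\,d\nu\Big)^{1/p}.$$ For a Borel set $B\subset Y$ define $\Psi(B)\in[0,\infty]$ by $$\Psi(B)^{1/\sigma}=\sup\Big\{\Big(\int_{\varphi^{-1}(B)}|\nabla_q(u\circ\varphi)|^q\,d\mu\Big)^{1/q}\ \Big|\ u\in\operatorname{Lip}(Y),\ \int_B|\nabla_pu|^p\,d\nu\le1\Big\}.$$ Then $$\widetilde\Psi(A)=\inf\{\Psi(U)\mid U\supset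 A \text{ open}\},\qquad A\subset Y,$$ is a finite regular Borel measure on $Y$ (an outer measure for which all Borel sets are measurable, with $\widetilde\Psi(Y)<\infty$, and such that every $A\subset Y$ lies in a Borel set $B$ with $\widetilde\Psi(B)=\widetilde\Psi(A)$), and it extends $\Psi$: $\widetilde\Psi(B)=\Psi(B)$ for every Borel set $B\subset Y$. -/

import Mathlib

open MeasureTheory Set
open scoped ENNReal NNReal

noncomputable section

namespace MetricSobolev

/-- A compact rectifiable curve in `X`, parametrised by arc length on `[0, L]`
(so that `γ` is `1`-Lipschitz, hence continuous, on `[0, L]`, and has length `L`).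
The values of `toFun` outside `[0, L]` play no role. Line integrals and end points of a
rectifiable curve are those of its arc length parametrisation. -/
structure RectCurve (X : Type*) [MetricSpace X] where
  length : ℝ
  length_nonneg : 0 ≤ length
  toFun : ℝ → X
  unitSpeed : HasUnitSpeedOn toFun (Icc 0 length)

/-- The line integral `∫_γ ρ ds`. -/
def RectCurve.lineIntegral {X : Type*} [MetricSpace X] (γ : RectCurve X) (ρ : X → ℝ≥0∞) : ℝ≥0∞ :=
  ∫⁻ t in Icc (0 : ℝ) γ.length, ρ (γ.toFun t)

section

variable {X : Type*} [MetricSpace X] [MeasurableSpace X]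

/-- The `p`-modulus of a family `Γ` of rectifiable curves: the infimum of `∫ ρ ^ p dμ` over the
Borel functions `ρ : X → [0, ∞]` with `∫_γ ρ ds ≥ 1` for every `γ ∈ Γ`. -/
def modulus (p : ℝ) (μ : Measure X) (Γ : Set (RectCurve X)) : ℝ≥0∞ :=
  ⨅ (ρ : X → ℝ≥0∞) (_ : Measurable ρ) (_ : ∀ γ ∈ Γ, 1 ≤ γ.lineIntegral ρ), ∫⁻ x, ρ x ^ p ∂μ

/-- `g : X → [0, ∞]` is a `p`-weak upper gradient of `u`: it is Borel, and
`|u(γ(0)) - u(γ(L))| ≤ ∫_γ g ds` for all rectifiable curves `γ` outside a family of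
`p`-modulus zero. -/
def IsWeakUpperGradient (p : ℝ) (μ : Measure X) (u : X → ℝ) (g : X → ℝ≥0∞) : Prop :=
  Measurable g ∧
    modulus p μ {γ : RectCurve X |
      ¬ edist (u (γ.toFun 0)) (u (γ.toFun γ.length)) ≤ γ.lineIntegral g} = 0

/-- `g ^ p` is integrable in a neighbourhood of every point. -/
def LocallyPIntegrable (p : ℝ) (μ : Measure X) (g : X → ℝ≥0∞) : Prop :=
  ∀ x : X, ∃ U : Set X, IsOpen U ∧ x ∈ U ∧ ∫⁻ y in U, g y ^ p ∂μ < ∞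

/-- `g` is a minimal `p`-weak upper gradient of `u`: the `μ`-a.e. smallest one among the
locally `p`-integrable `p`-weak upper gradients of `u`. -/
def IsMinWeakUpperGradient (p : ℝ) (μ : Measure X) (u : X → ℝ) (g : X → ℝ≥0∞) : Prop :=
  IsWeakUpperGradient p μ u g ∧ LocallyPIntegrable p μ g ∧
    ∀ g' : X → ℝ≥0∞, IsWeakUpperGradient p μ u g' → LocallyPIntegrable p μ g' →
      ∀ᵐ x ∂μ, g x ≤ g' x

open Classical in
/-- `|∇_p u|`: the minimal `p`-weak upper gradient of `u`, well defined up to `μ`-null sets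
(and `∞` by convention if there is none). -/
def minGrad (p : ℝ) (μ : Measure X) (u : X → ℝ) : X → ℝ≥0∞ :=
  if h : ∃ g : X → ℝ≥0∞, IsMinWeakUpperGradient p μ u g then h.choose else fun _ => ∞

/-- The Dirichlet–Sobolev space `D^{1,p}(X)`: the `μ`-measurable functions that have a
`p`-integrable `p`-weak upper gradient. -/
def MemD (p : ℝ) (μ : Measure X) (u : X → ℝ) : Prop :=
  AEMeasurable u μ ∧ ∃ g : X → ℝ≥0∞, IsWeakUpperGradient p μ u g ∧ ∫⁻ x, g x ^ p ∂μ < ∞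

/-- The requirements on the measure of a metric measure space: it is nontrivial, and finite on
bounded sets. (A Mathlib measure on the Borel `σ`-algebra is Borel regular as an outer measure.) -/
structure IsMetricMeasure (μ : Measure X) : Prop where
  nontrivial : μ ≠ 0
  finite_of_bounded : ∀ s : Set X, Bornology.IsBounded s → μ s < ∞

/-- A Radon measure: finite on compact sets, and every `μ`-measurable set is approximated in
measure from inside by compact sets. -/
structure IsRadon (μ : Measure X) : Prop where
  finite_of_compact : ∀ K : Set X, IsCompact K → μ K < ∞
  inner_compact : ∀ A : Set X, NullMeasurableSet A μ →
    μ A = ⨆ (K : Set X) (_ : IsCompact K) (_ : K ⊆ A), μ K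

end

/-- `u` is a Lipschitz function on `X`. -/
def IsLip {X : Type*} [MetricSpace X] (u : X → ℝ) : Prop := ∃ K : ℝ≥0, LipschitzWith K u

section

variable {X Y : Type*} [MetricSpace X] [MeasurableSpace X] [MetricSpace Y] [MeasurableSpace Y]

/-- `φ` induces the bounded composition operator
`φ* : D^{1,p}(Y) ∩ Lip(Y) → D^{1,q}(X)`, `φ* u = u ∘ φ`. -/
def InducesBoundedCompOp (p q : ℝ) (μ : Measure X) (ν : Measure Y) (φ : X → Y) : Prop :=
  ∃ C : ℝ≥0, ∀ u : Y → ℝ, MemD p ν u → IsLip u →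
    MemD q μ (u ∘ φ) ∧
      (∫⁻ x, minGrad q μ (u ∘ φ) x ^ q ∂μ) ^ (1 / q) ≤
        C * (∫⁻ y, minGrad p ν u y ^ p ∂ν) ^ (1 / p)

/-- The set function `Ψ`, that is, the `σ`-th power of
`sup (∫_{φ⁻¹(B)} |∇_q (u ∘ φ)| ^ q dμ) ^ (1 / q)`, where the supremum is over all Lipschitz
functions `u` on `Y` with `∫_B |∇_p u| ^ p dν ≤ 1`. -/
def Psi (p q σ : ℝ) (μ : Measure X) (ν : Measure Y) (φ : X → Y) (B : Set Y) : ℝ≥0∞ :=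
  (⨆ (u : Y → ℝ) (_ : IsLip u) (_ : ∫⁻ y in B, minGrad p ν u y ^ p ∂ν ≤ 1),
    (∫⁻ x in φ ⁻¹' B, minGrad q μ (u ∘ φ) x ^ q ∂μ) ^ (1 / q)) ^ σ

end

end MetricSobolev

end

/-! On Borel sets `Psi` is itself a finite measure. Once this is known, the formula with open sets
is the outer regularity of finite Borel measures on metric spaces.

Write E(u,B) = ∫_B |∇_p u|^p dν and F(u,B) = ∫_{φ⁻¹(B)} |∇_q(u∘φ)|^q dμ, both measures in B. By
homogeneity F(u,B) ≤ Ψ(B)^(q/σ) E(u,B)^(q/p) whenever E(u,B) is finite (`compEnergy_le_Psi_mul`). As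
q/σ + q/p = 1, Hölder's inequality for sums bounds Ψ of a disjoint union by the sum of the values.

The reverse inequality (`Psi_add_le`) scales competitors as in the equality case of Hölder, and then
needs one Lipschitz function doing the work of u₁ on B₁ and of u₂ on B₂. By inner approximation the
two sets may be taken closed, bounded and at positive distance. An ordinary cutoff of u would cost a
term of the size of |u|. Instead u is first composed with a sawtooth of slopes ±1 and small
amplitude a: this does not increase the gradient on Y, does not decrease that of the composition on
X, and a cutoff of height a over distance s adds only slope a/s (`exists_localization`,
`exists_glued`). The same construction bounds Ψ, although its competitors need not lie in
D^{1,p}(Y).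

Underneath lies the calculus of weak upper gradients, read along almost every curve as a bound on
the derivative of u∘γ. It yields gluing along Borel sets, minimal gradients, and the invariance
under the sawtooth. -/

open Filter Topology

namespace MetricSobolev

/-! ### Absolutely continuous functions on an interval -/

/-- The oscillation of `f` on subintervals of `[0, L]` is bounded by the integral of `h`. -/
def Dominates (f : ℝ → ℝ) (h : ℝ → ℝ≥0∞) (L : ℝ) : Prop :=
  ∀ s t, 0 ≤ s → s ≤ t → t ≤ L → edist (f s) (f t) ≤ ∫⁻ r in Icc s t, h r

/-- `h` is measurable with finite integral on `[0, L]`. -/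
def FiniteOn (h : ℝ → ℝ≥0∞) (L : ℝ) : Prop :=
  AEMeasurable h (volume.restrict (Icc 0 L)) ∧ ∫⁻ r in Icc 0 L, h r ≠ ∞

theorem FiniteOn.exists_primitive {h : ℝ → ℝ≥0∞} {L : ℝ} (hL : 0 ≤ L) (hh : FiniteOn h L) :
    ∃ F : ℝ → ℝ, AbsolutelyContinuousOnInterval F 0 L ∧
      (∀ s t, 0 ≤ s → s ≤ t → t ≤ L →
        F s ≤ F t ∧ ∫⁻ r in Icc s t, h r = ENNReal.ofReal (F t - F s)) ∧
      ∀ᵐ t, t ∈ Icc 0 L → HasDerivAt F (h t).toReal t := by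
  have hint : IntegrableOn (fun r => (h r).toReal) (Icc 0 L) :=
    integrable_toReal_of_lintegral_ne_top hh.1 hh.2
  have hii : IntervalIntegrable (fun r => (h r).toReal) volume 0 L :=
    (intervalIntegrable_iff_integrableOn_Icc_of_le hL).2 hint
  have hlt : ∀ᵐ r ∂(volume.restrict (Icc 0 L)), h r < ∞ := ae_lt_top' hh.1 hh.2
  refine ⟨fun t => ∫ r in (0 : ℝ)..t, (h r).toReal,
    hii.absolutelyContinuousOnInterval_intervalIntegral (by simp), ?_, ?_⟩
  · intro s t hs hst ht
    have hsub : Icc s t ⊆ Icc 0 L := Icc_subset_Icc hs ht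
    have hi : ∀ a b, 0 ≤ a → a ≤ b → b ≤ L →
        IntervalIntegrable (fun r => (h r).toReal) volume a b := fun a b ha hab hb =>
      (intervalIntegrable_iff_integrableOn_Icc_of_le hab).2
        (hint.mono_set (Icc_subset_Icc ha hb))
    have h1 : (∫ r in (0 : ℝ)..t, (h r).toReal) - ∫ r in (0 : ℝ)..s, (h r).toReal
        = ∫ r in s..t, (h r).toReal :=
      intervalIntegral.integral_interval_sub_left (hi 0 t le_rfl (hs.trans hst) ht)
        (hi 0 s le_rfl hs (hst.trans ht))
    have h2 : 0 ≤ ∫ r in s..t, (h r).toReal :=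
      intervalIntegral.integral_nonneg hst fun _ _ => ENNReal.toReal_nonneg
    refine ⟨by linarith, ?_⟩
    rw [h1, intervalIntegral.integral_of_le hst, ← integral_Icc_eq_integral_Ioc,
      ofReal_integral_eq_lintegral_ofReal (hint.mono_set hsub)
        (ae_of_all _ fun _ => ENNReal.toReal_nonneg)]
    refine lintegral_congr_ae ?_
    filter_upwards [ae_mono (Measure.restrict_mono hsub le_rfl) hlt] with r hr
    rw [ENNReal.ofReal_toReal hr.ne]
  · filter_upwards [hii.ae_hasDerivAt_integral] with t ht htm
    exact ht (by rwa [uIcc_of_le hL]) 0 (by simp)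

theorem Dominates.dist_le {f : ℝ → ℝ} {h : ℝ → ℝ≥0∞} {L : ℝ} (hd : Dominates f h L)
    {F : ℝ → ℝ} (hF : ∀ s t, 0 ≤ s → s ≤ t → t ≤ L →
        F s ≤ F t ∧ ∫⁻ r in Icc s t, h r = ENNReal.ofReal (F t - F s)) {s t : ℝ}
    (hs : s ∈ Icc 0 L) (ht : t ∈ Icc 0 L) : dist (f s) (f t) ≤ dist (F s) (F t) := by
  wlog hst : s ≤ t generalizing s t
  · rw [dist_comm, dist_comm (F s)]
    exact this ht hs (le_of_not_ge hst)
  obtain ⟨h1, h2⟩ := hF s t hs.1 hst ht.2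
  have := hd s t hs.1 hst ht.2
  rw [h2, edist_dist, ENNReal.ofReal_le_ofReal_iff (by linarith)] at this
  rw [dist_comm (F s), Real.dist_eq (F t), abs_of_nonneg (by linarith)]
  exact this

theorem Dominates.absolutelyContinuous {f : ℝ → ℝ} {h : ℝ → ℝ≥0∞} {L : ℝ} (hL : 0 ≤ L)
    (hd : Dominates f h L) (hh : FiniteOn h L) : AbsolutelyContinuousOnInterval f 0 L := by
  obtain ⟨F, hF, hF', -⟩ := hh.exists_primitive hL
  rw [absolutelyContinuousOnInterval_iff] at hF ⊢
  intro ε hε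
  obtain ⟨δ, hδ, H⟩ := hF ε hε
  refine ⟨δ, hδ, fun E hE hE' => lt_of_le_of_lt (Finset.sum_le_sum fun i hi => ?_) (H E hE hE')⟩
  have := hE.1 i hi
  rw [uIcc_of_le hL] at this
  exact hd.dist_le hF' this.1 this.2

/-- The difference quotients of `f` are bounded by those of a primitive of `h`, which has derivative
`h` almost everywhere. -/
theorem Dominates.ae_enorm_deriv_le {f : ℝ → ℝ} {h : ℝ → ℝ≥0∞} {L : ℝ} (hL : 0 ≤ L)
    (hd : Dominates f h L) (hh : FiniteOn h L) :
    ∀ᵐ t, t ∈ Icc 0 L → HasDerivAt f (deriv f t) t ∧ ‖deriv f t‖ₑ ≤ h t := by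
  have hac := hd.absolutelyContinuous hL hh
  obtain ⟨F, hF, hF', hFd⟩ := hh.exists_primitive hL
  have e0 : ∀ᵐ t : ℝ, t ≠ 0 := by simp [ae_iff, measure_singleton]
  have eL : ∀ᵐ t : ℝ, t ≠ L := by simp [ae_iff, measure_singleton]
  filter_upwards [hac.ae_differentiableAt, hFd, e0, eL] with t h1 h2 ht0 htL ht
  have h1 := (h1 (by rwa [uIcc_of_le hL])).hasDerivAt
  refine ⟨h1, ?_⟩
  have h2 := h2 ht
  have hnb : Icc 0 L ∈ 𝓝 t :=
    Icc_mem_nhds (lt_of_le_of_ne ht.1 ht0.symm) (lt_of_le_of_ne ht.2 htL)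
  have key : ‖deriv f t‖ ≤ ‖(h t).toReal‖ := by
    refine le_of_tendsto_of_tendsto h1.tendsto_slope.norm h2.tendsto_slope.norm ?_
    filter_upwards [nhdsWithin_le_nhds hnb] with s hs
    rw [slope_def_field, slope_def_field, norm_div, norm_div, ← dist_eq_norm, ← dist_eq_norm]
    gcongr
    exact hd.dist_le hF' hs ht
  rw [← ofReal_norm]
  refine (ENNReal.ofReal_le_ofReal key).trans ?_
  rw [Real.norm_of_nonneg ENNReal.toReal_nonneg]
  exact ENNReal.ofReal_toReal_le

theorem dominates_of_ae_enorm_deriv_le {f : ℝ → ℝ} {h : ℝ → ℝ≥0∞} {L : ℝ} (hL : 0 ≤ L)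
    (hac : AbsolutelyContinuousOnInterval f 0 L)
    (hh : ∀ᵐ t, t ∈ Icc 0 L → ‖deriv f t‖ₑ ≤ h t) : Dominates f h L := by
  intro s t hs hst ht
  have hac' : AbsolutelyContinuousOnInterval f s t := hac.mono (by
    rw [uIcc_of_le hL, uIcc_of_le hst]; exact Icc_subset_Icc hs ht)
  rw [edist_comm, edist_eq_enorm_sub, ← hac'.integral_deriv_eq_sub,
    intervalIntegral.integral_of_le hst, ← integral_Icc_eq_integral_Ioc]
  refine (enorm_integral_le_lintegral_enorm _).trans (lintegral_mono_ae ?_)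
  rw [ae_restrict_iff' measurableSet_Icc]
  filter_upwards [hh] with r hr hrm
  exact hr (Icc_subset_Icc hs ht hrm)

/-- Almost every point of a set of reals is a limit of larger points of the set. -/
theorem ae_frequently_nhdsGT (A : Set ℝ) : ∀ᵐ t : ℝ, t ∈ A → ∃ᶠ s in 𝓝[>] t, s ∈ A := by
  -- Points of a set of reals that are isolated from the right within it are countable in number.
  have hc : {t : ℝ | t ∈ A ∧ ¬ ∃ᶠ s in 𝓝[>] t, s ∈ A}.Countable := by
    refine (countable_setOfPred_isolated_right_within (s := A)).mono ?_
    rintro t ⟨ht, hf⟩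
    rw [not_frequently] at hf
    refine ⟨ht, ?_⟩
    rw [inter_comm, ← Filter.empty_mem_iff_bot, nhdsWithin_inter', mem_inf_principal]
    filter_upwards [hf] with s hs hsA using hs hsA
  filter_upwards [(measure_eq_zero_iff_ae_notMem).1 (hc.measure_zero volume)] with t ht htA
  by_contra hcon
  exact ht ⟨htA, hcon⟩

/-- At almost every point of `A n` both `f` and `f' n` are differentiable and the point is a limit
from the right of `A n`, so the derivatives are limits of common difference quotients and agree. The
bound `h₀` serves only to make `f` absolutely continuous; `h` need not be measurable. -/
theorem Dominates.glue {ι : Type*} [Countable ι] {f : ℝ → ℝ} {h h₀ : ℝ → ℝ≥0∞} {L : ℝ}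
    (hL : 0 ≤ L) (hd : Dominates f h₀ L) (hh : FiniteOn h₀ L) {f' : ι → ℝ → ℝ}
    {h' : ι → ℝ → ℝ≥0∞} (hd' : ∀ n, Dominates (f' n) (h' n) L) (hh' : ∀ n, FiniteOn (h' n) L)
    {A : ι → Set ℝ} (hA : Icc 0 L ⊆ ⋃ n, A n) (hf : ∀ n, ∀ t ∈ A n, t ∈ Icc 0 L → f t = f' n t)
    (hle : ∀ n, ∀ t ∈ A n, h' n t ≤ h t) : Dominates f h L := by
  refine dominates_of_ae_enorm_deriv_le hL (hd.absolutelyContinuous hL hh) ?_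
  have h1 := fun n => (hd' n).ae_enorm_deriv_le hL (hh' n)
  have h2 := fun n => ae_frequently_nhdsGT (A n ∩ Icc 0 L)
  filter_upwards [hd.ae_enorm_deriv_le hL hh, ae_all_iff.2 h1, ae_all_iff.2 h2] with t h0 h1 h2 ht
  obtain ⟨n, hn⟩ := mem_iUnion.1 (hA ht)
  have hft := (h0 ht).1
  obtain ⟨hft', hle'⟩ := h1 n ht
  have hfr := h2 n ⟨hn, ht⟩
  have : deriv f t = deriv (f' n) t := by
    have hs := (hft.sub hft').tendsto_slope.mono_left
      (nhdsWithin_mono t (s := Ioi t) fun x hx => ne_of_gt hx)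
    by_contra hne
    have hev := hs.eventually_ne (sub_ne_zero.2 hne)
    obtain ⟨s, ⟨hsA, hsI⟩, hs'⟩ := (hfr.and_eventually hev).exists
    apply hs'
    simp [slope_def_field, hf n s hsA hsI, hf n t hn ht]
  rw [this]
  exact hle'.trans (hle n t hn)

/-- Continuous induction on the `r` with |f s - f r| ≤ F r - F s, where `F` is a primitive of `h`.
Each step moves to the right of one point, so a comparison with the centre `t` alone suffices. -/
theorem Dominates.of_local {f w : ℝ → ℝ} {h : ℝ → ℝ≥0∞} {L : ℝ} (hL : 0 ≤ L)
    (hd : Dominates w h L) (hh : FiniteOn h L) (hf : ContinuousOn f (Icc 0 L))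
    (hloc : ∀ t ∈ Icc 0 L, ∀ᶠ s in 𝓝[Icc 0 L] t, dist (f t) (f s) ≤ dist (w t) (w s)) :
    Dominates f h L := by
  obtain ⟨F, hF, hF', -⟩ := hh.exists_primitive hL
  have hFc : ContinuousOn F (Icc 0 L) := by
    have := hF.continuousOn; rwa [uIcc_of_le hL] at this
  intro s t hs hst ht
  rw [(hF' s t hs hst ht).2, edist_dist]
  refine ENNReal.ofReal_le_ofReal ?_
  have hsub : Icc s t ⊆ Icc 0 L := Icc_subset_Icc hs ht
  have hcl : IsClosed ({r | dist (f s) (f r) ≤ F r - F s} ∩ Icc s t) := by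
    have : {r | dist (f s) (f r) ≤ F r - F s} ∩ Icc s t
        = {r ∈ Icc s t | dist (f s) (f r) ≤ F r - F s} := by ext; simp [and_comm]
    rw [this]
    exact isClosed_Icc.isClosed_le (continuous_const.dist continuous_id |>.comp_continuousOn (hf.mono hsub))
      ((hFc.mono hsub).sub continuousOn_const)
  refine hcl.Icc_subset_of_forall_mem_nhdsWithin (by simp) ?_ (right_mem_Icc.2 hst)
  rintro r ⟨hr, hrm⟩
  have hrI : r ∈ Icc 0 L := hsub (Ico_subset_Icc_self hrm)
  have hnb : 𝓝[>] r ≤ 𝓝[Icc 0 L] r := by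
    rw [← nhdsWithin_Ioc_eq_nhdsGT (hrm.2.trans_le ht)]
    exact nhdsWithin_mono _ fun x hx => ⟨hrI.1.trans hx.1.le, hx.2⟩
  filter_upwards [hnb (hloc r hrI), hnb self_mem_nhdsWithin, self_mem_nhdsWithin] with x hx hxI hrx
  have h1 := hd.dist_le hF' hrI hxI
  have h2 := (hF' r x hrI.1 (le_of_lt hrx) hxI.2).1
  rw [dist_comm (F r), Real.dist_eq (F x), abs_of_nonneg (by linarith)] at h1
  have h3 := dist_triangle (f s) (f r) (f x)
  have : dist (f s) (f r) ≤ F r - F s := hr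
  show dist (f s) (f x) ≤ F x - F s
  linarith

/-! ### Rectifiable curves and their subcurves -/

namespace RectCurve

variable {X : Type*} [MetricSpace X]

theorem edist_le (γ : RectCurve X) {s t : ℝ} (hs : 0 ≤ s) (hst : s ≤ t) (ht : t ≤ γ.length) :
    edist (γ.toFun s) (γ.toFun t) ≤ ENNReal.ofReal (t - s) := by
  have hs' : s ∈ Icc 0 γ.length := ⟨hs, hst.trans ht⟩
  have ht' : t ∈ Icc 0 γ.length := ⟨hs.trans hst, ht⟩
  have h := γ.unitSpeed hs' ht'
  simp only [NNReal.coe_one, one_mul] at h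
  rw [← h]
  exact eVariationOn.edist_le _ ⟨hs', left_mem_Icc.2 hst⟩ ⟨ht', right_mem_Icc.2 hst⟩

theorem lipschitzOnWith (γ : RectCurve X) : LipschitzOnWith 1 γ.toFun (Icc 0 γ.length) := by
  intro s hs t ht
  rw [ENNReal.coe_one, one_mul]
  wlog hst : s ≤ t generalizing s t
  · rw [edist_comm, edist_comm s]
    exact this ht hs (le_of_not_ge hst)
  refine (γ.edist_le hs.1 hst ht.2).trans ?_
  rw [edist_comm, edist_dist, Real.dist_eq, abs_of_nonneg (by linarith)]

theorem continuousOn (γ : RectCurve X) : ContinuousOn γ.toFun (Icc 0 γ.length) :=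
  γ.lipschitzOnWith.continuousOn

/-- The restriction of a curve to a subinterval, shifted to start at time `0`. -/
def sub (γ : RectCurve X) (s t : ℝ) (hs : 0 ≤ s) (hst : s ≤ t) (ht : t ≤ γ.length) :
    RectCurve X where
  length := t - s
  length_nonneg := by linarith
  toFun := γ.toFun ∘ fun r => s + r
  unitSpeed := by
    intro x hx y hy
    have h := γ.unitSpeed (x := s + x) ⟨by linarith [hx.1], by linarith [hx.2]⟩
      (y := s + y) ⟨by linarith [hy.1], by linarith [hy.2]⟩
    rw [eVariationOn.comp_eq_of_monotoneOn _ _ fun a _ b _ hab => by simpa using hab]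
    rw [show (1 : ℝ≥0) * (y - x) = (1 : ℝ≥0) * (s + y - (s + x)) by ring, ← h]
    congr 1
    ext r
    simp only [mem_image, mem_inter_iff, mem_Icc]
    constructor
    · rintro ⟨r, hr, rfl⟩
      exact ⟨⟨by linarith [hr.1.1], by linarith [hr.1.2]⟩, by linarith [hr.2.1], by linarith [hr.2.2]⟩
    · intro hr
      exact ⟨r - s, ⟨⟨by linarith [hr.2.1, hx.1], by linarith [hr.2.2, hy.2]⟩,
        by linarith [hr.2.1], by linarith [hr.2.2]⟩, by ring⟩

theorem lineIntegral_sub (γ : RectCurve X) (s t : ℝ) (hs : 0 ≤ s) (hst : s ≤ t)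
    (ht : t ≤ γ.length) (ρ : X → ℝ≥0∞) :
    (γ.sub s t hs hst ht).lineIntegral ρ = ∫⁻ r in Icc s t, ρ (γ.toFun r) := by
  have h := (measurePreserving_add_left volume s).setLIntegral_comp_preimage_emb
    (measurableEmbedding_addLeft s) (fun r => ρ (γ.toFun r)) (Icc s t)
  rw [← h]
  simp [lineIntegral, sub]

theorem lineIntegral_mono (γ : RectCurve X) {ρ ρ' : X → ℝ≥0∞} (h : ∀ x, ρ x ≤ ρ' x) :
    γ.lineIntegral ρ ≤ γ.lineIntegral ρ' :=
  lintegral_mono fun _ => h _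

theorem aemeasurable_comp [MeasurableSpace X] [BorelSpace X] (γ : RectCurve X)
    {ρ : X → ℝ≥0∞} (hρ : Measurable ρ) :
    AEMeasurable (fun t => ρ (γ.toFun t)) (volume.restrict (Icc 0 γ.length)) :=
  hρ.comp_aemeasurable (γ.continuousOn.aemeasurable measurableSet_Icc)

end RectCurve

/-! ### Modulus and exceptional families of curves -/

section

variable {X : Type*} [MeasurableSpace X]

theorem lintegral_iSup_rpow_le {p : ℝ} (hp : 0 < p) (μ : Measure X) {ρ : ℕ → X → ℝ≥0∞}
    (hρ : ∀ n, Measurable (ρ n)) :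
    ∫⁻ x, (⨆ n, ρ n x) ^ p ∂μ ≤ ∑' n, ∫⁻ x, ρ n x ^ p ∂μ := by
  rw [← lintegral_tsum fun n => ((hρ n).pow_const p).aemeasurable]
  refine lintegral_mono fun x => ?_
  have : (⨆ n, ρ n x) ^ p = ⨆ n, ρ n x ^ p := (ENNReal.orderIsoRpow p hp).map_iSup _
  rw [this]
  exact iSup_le fun n => ENNReal.le_tsum n

/-- Countably many `p`-integrable functions are, up to positive factors, bounded by one. -/
theorem exists_lintegral_rpow_lt_top_of_countable {p : ℝ} (hp : 0 < p) (μ : Measure X)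
    {ρ : ℕ → X → ℝ≥0∞} (hρ : ∀ n, Measurable (ρ n)) (hfin : ∀ n, ∫⁻ x, ρ n x ^ p ∂μ < ∞) :
    ∃ (ρ' : X → ℝ≥0∞) (c : ℕ → ℝ≥0∞), Measurable ρ' ∧ ∫⁻ x, ρ' x ^ p ∂μ < ∞ ∧
      ∀ n, c n ≠ 0 ∧ ∀ x, c n * ρ n x ≤ ρ' x := by
  set I : ℕ → ℝ≥0∞ := fun n => ∫⁻ x, ρ n x ^ p ∂μ
  -- This makes the energy of `c n * ρ n` at most 2⁻ⁿ; the summand 1 avoids division by zero.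
  set c : ℕ → ℝ≥0∞ := fun n => ((1 / 2) ^ n / (1 + I n)) ^ (1 / p)
  have h1 : ∀ n, 1 + I n ≠ ∞ := fun n => ENNReal.add_ne_top.2 ⟨ENNReal.one_ne_top, (hfin n).ne⟩
  have hcp : ∀ n, c n ^ p = (1 / 2) ^ n / (1 + I n) := fun n => by
    rw [← ENNReal.rpow_mul, one_div_mul_cancel hp.ne', ENNReal.rpow_one]
  refine ⟨fun x => ⨆ n, c n * ρ n x, c, Measurable.iSup fun n => (hρ n).const_mul _, ?_,
    fun n => ⟨?_, fun x => le_iSup (fun n => c n * ρ n x) n⟩⟩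
  · refine (lintegral_iSup_rpow_le hp μ fun n => (hρ n).const_mul _).trans_lt ?_
    refine lt_of_le_of_lt (ENNReal.tsum_le_tsum (g := fun n => (1 / 2) ^ n) fun n => ?_) ?_
    · simp_rw [ENNReal.mul_rpow_of_nonneg _ _ hp.le]
      rw [lintegral_const_mul _ ((hρ n).pow_const p), hcp]
      calc (1 / 2) ^ n / (1 + I n) * I n ≤ (1 / 2) ^ n / (1 + I n) * (1 + I n) := by
            gcongr; exact le_add_self
        _ ≤ (1 / 2) ^ n := by rw [mul_comm]; exact ENNReal.mul_div_le
    · simp only [one_div]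
      rw [ENNReal.tsum_geometric_two]
      exact ENNReal.ofNat_lt_top
  · rw [Ne, ENNReal.rpow_eq_zero_iff_of_pos (by positivity)]
    exact ENNReal.div_ne_zero.2 ⟨by simp, h1 n⟩

end

section

variable {X : Type*} [MetricSpace X] [MeasurableSpace X]

/-- `γ` satisfies a property eventually along `aeCurve p μ hp` if it does outside a family of
curves of `p`-modulus zero. -/
def aeCurve (p : ℝ) (μ : Measure X) (hp : 0 < p) : Filter (RectCurve X) where
  sets := {S | ∃ ρ : X → ℝ≥0∞, Measurable ρ ∧ ∫⁻ x, ρ x ^ p ∂μ < ∞ ∧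
    ∀ γ : RectCurve X, γ.lineIntegral ρ ≠ ∞ → γ ∈ S}
  univ_sets := ⟨0, measurable_const, by simp [hp], fun _ _ => mem_univ _⟩
  sets_of_superset := by
    rintro S T ⟨ρ, h1, h2, h3⟩ hST
    exact ⟨ρ, h1, h2, fun γ hγ => hST (h3 γ hγ)⟩
  inter_sets := by
    rintro S T ⟨ρ, h1, h2, h3⟩ ⟨ρ', h1', h2', h3'⟩
    refine ⟨fun x => max (ρ x) (ρ' x), h1.max h1', ?_, fun γ hγ => ⟨h3 γ ?_, h3' γ ?_⟩⟩
    · refine lt_of_le_of_lt (lintegral_mono (g := fun x => ρ x ^ p + ρ' x ^ p) fun x => ?_) ?_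
      · rcases max_choice (ρ x) (ρ' x) with h | h <;> simp [h]
      · rw [lintegral_add_left (h1.pow_const p)]
        exact ENNReal.add_lt_top.2 ⟨h2, h2'⟩
    · exact ne_top_of_le_ne_top hγ (γ.lineIntegral_mono fun x => le_max_left _ _)
    · exact ne_top_of_le_ne_top hγ (γ.lineIntegral_mono fun x => le_max_right _ _)

variable {p : ℝ} {μ : Measure X}

theorem mem_aeCurve {hp : 0 < p} {S : Set (RectCurve X)} :
    S ∈ aeCurve p μ hp ↔ ∃ ρ : X → ℝ≥0∞, Measurable ρ ∧ ∫⁻ x, ρ x ^ p ∂μ < ∞ ∧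
      ∀ γ : RectCurve X, γ.lineIntegral ρ ≠ ∞ → γ ∈ S := Iff.rfl

theorem eventually_aeCurve_of_seq (hp : 0 < p) {P : ℕ → RectCurve X → Prop}
    (h : ∀ n, ∀ᶠ γ in aeCurve p μ hp, P n γ) : ∀ᶠ γ in aeCurve p μ hp, ∀ n, P n γ := by
  choose ρ h1 h2 h3 using fun n => mem_aeCurve.1 (h n)
  obtain ⟨ρ', c, hm, hf, hc⟩ := exists_lintegral_rpow_lt_top_of_countable hp μ h1 h2
  refine mem_aeCurve.2 ⟨ρ', hm, hf, fun γ hγ n => h3 n γ fun htop => hγ ?_⟩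
  refine top_le_iff.1 (le_trans ?_ (γ.lineIntegral_mono (hc n).2))
  refine le_trans ?_ (lintegral_const_mul_le _ _)
  have : ∫⁻ t in Icc 0 γ.length, ρ n (γ.toFun t) = ∞ := htop
  rw [this, ENNReal.mul_top (hc n).1]

instance (hp : 0 < p) : CountableInterFilter (aeCurve p μ hp) where
  countable_sInter_mem := by
    intro S hS h
    rcases S.eq_empty_or_nonempty with rfl | hne
    · simp
    obtain ⟨f, rfl⟩ := hS.exists_eq_range hne
    have := eventually_aeCurve_of_seq hp (P := fun n γ => γ ∈ f n) fun n => h _ ⟨n, rfl⟩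
    filter_upwards [this] with γ hγ
    simpa using hγ

/-- Fuglede's criterion. Admissible densities of rapidly decreasing energy, weighted by n + 1, have
a `p`-integrable supremum with infinite integral along every curve of `Γ`. Conversely, every
positive multiple of a density with infinite integrals is admissible, and small multiples have small
energy. -/
theorem modulus_eq_zero_iff (hp : 0 < p) {Γ : Set (RectCurve X)} :
    modulus p μ Γ = 0 ↔ Γᶜ ∈ aeCurve p μ hp := by
  constructor
  · intro h
    have hex : ∀ n : ℕ, ∃ ρ : X → ℝ≥0∞, Measurable ρ ∧ (∀ γ ∈ Γ, 1 ≤ γ.lineIntegral ρ) ∧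
        ∫⁻ x, ρ x ^ p ∂μ < (1 / 2) ^ n / ((n : ℝ≥0∞) + 1) ^ p := by
      intro n
      have : modulus p μ Γ < (1 / 2) ^ n / ((n : ℝ≥0∞) + 1) ^ p := by
        rw [h]
        refine ENNReal.div_pos (by simp) (ENNReal.rpow_ne_top_of_nonneg hp.le (by simp))
      simpa only [modulus, iInf_lt_iff, exists_prop] using this
    choose ρ h1 h2 h3 using hex
    refine mem_aeCurve.2 ⟨fun x => ⨆ n : ℕ, ((n : ℝ≥0∞) + 1) * ρ n x,
      Measurable.iSup fun n => (h1 n).const_mul _, ?_, fun γ hγ hmem => hγ ?_⟩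
    · refine (lintegral_iSup_rpow_le hp μ fun n => (h1 n).const_mul _).trans_lt ?_
      refine lt_of_le_of_lt (ENNReal.tsum_le_tsum (g := fun n => (1 / 2) ^ n) fun n => ?_) ?_
      · simp_rw [ENNReal.mul_rpow_of_nonneg _ _ hp.le]
        rw [lintegral_const_mul _ ((h1 n).pow_const p), mul_comm]
        exact (mul_le_mul_left (h3 n).le _).trans (by rw [mul_comm]; exact ENNReal.mul_div_le)
      · simp only [one_div]
        rw [ENNReal.tsum_geometric_two]
        exact ENNReal.ofNat_lt_top
    · refine ENNReal.eq_top_of_forall_nnreal_le fun r => ?_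
      obtain ⟨n, hn⟩ := exists_nat_ge r
      calc (r : ℝ≥0∞) ≤ (n : ℝ≥0∞) + 1 := by
            refine le_trans ?_ le_self_add
            exact_mod_cast hn
        _ ≤ ((n : ℝ≥0∞) + 1) * γ.lineIntegral (ρ n) := le_mul_of_one_le_right' (h2 n γ hmem)
        _ ≤ γ.lineIntegral fun x => ((n : ℝ≥0∞) + 1) * ρ n x := lintegral_const_mul_le _ _
        _ ≤ _ := γ.lineIntegral_mono fun x => le_iSup (fun n : ℕ => ((n : ℝ≥0∞) + 1) * ρ n x) n
  · intro h
    obtain ⟨ρ, h1, h2, h3⟩ := mem_aeCurve.1 h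
    refine nonpos_iff_eq_zero.1 (le_of_forall_pos_le_add fun ε hε => ?_)
    rw [zero_add]
    set I := ∫⁻ x, ρ x ^ p ∂μ
    have hI : 1 + I ≠ ∞ := ENNReal.add_ne_top.2 ⟨ENNReal.one_ne_top, h2.ne⟩
    set c : ℝ≥0∞ := (ε / (1 + I)) ^ (1 / p)
    have hc : c ≠ 0 := by
      rw [Ne, ENNReal.rpow_eq_zero_iff_of_pos (by positivity)]
      exact ENNReal.div_ne_zero.2 ⟨hε.ne', hI⟩
    have hcp : c ^ p = ε / (1 + I) := by
      rw [← ENNReal.rpow_mul, one_div_mul_cancel hp.ne', ENNReal.rpow_one]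
    refine (iInf₂_le_of_le (fun x => c * ρ x) (h1.const_mul _) (iInf_le_of_le ?_ le_rfl)).trans ?_
    · intro γ hγ
      have : γ.lineIntegral ρ = ∞ := by
        by_contra hne
        exact h3 γ hne hγ
      refine le_trans ?_ (lintegral_const_mul_le _ _)
      change 1 ≤ c * γ.lineIntegral ρ
      rw [this, ENNReal.mul_top hc]
      exact le_top
    · simp_rw [ENNReal.mul_rpow_of_nonneg _ _ hp.le]
      rw [lintegral_const_mul _ (h1.pow_const p), hcp]
      calc ε / (1 + I) * I ≤ ε / (1 + I) * (1 + I) := by gcongr; exact le_add_self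
        _ ≤ ε := by rw [mul_comm]; exact ENNReal.mul_div_le

/-- A curve along which `ρ` has finite integral has only subcurves of that kind, so the inequality
at the end points holds on all subcurves simultaneously. -/
theorem isWeakUpperGradient_iff (hp : 0 < p) {u : X → ℝ} {g : X → ℝ≥0∞} :
    IsWeakUpperGradient p μ u g ↔ Measurable g ∧ ∀ᶠ γ in aeCurve p μ hp,
      Dominates (fun t => u (γ.toFun t)) (fun t => g (γ.toFun t)) γ.length := by
  rw [IsWeakUpperGradient, modulus_eq_zero_iff hp]
  refine and_congr_right fun _ => ⟨fun h => ?_, fun h => ?_⟩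
  · obtain ⟨ρ, h1, h2, h3⟩ := mem_aeCurve.1 h
    refine mem_aeCurve.2 ⟨ρ, h1, h2, fun γ hγ s t hs hst ht => ?_⟩
    have h4 := h3 (γ.sub s t hs hst ht) (by
      rw [RectCurve.lineIntegral_sub]
      exact ne_top_of_le_ne_top hγ (lintegral_mono_set (Icc_subset_Icc hs ht)))
    have h5 : edist (u (γ.toFun (s + 0))) (u (γ.toFun (s + (t - s)))) ≤
        (γ.sub s t hs hst ht).lineIntegral g := not_not.1 h4
    rw [RectCurve.lineIntegral_sub] at h5
    simpa using h5
  · filter_upwards [h] with γ hγ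
    exact not_not.2 (hγ 0 γ.length le_rfl γ.length_nonneg le_rfl)

/-- By Lindelöf, countably many neighbourhoods with finite energy cover the space. Almost every
curve has finite integral in each of them, and its compact image needs only finitely many. -/
theorem LocallyPIntegrable.finiteOn [BorelSpace X] [SecondCountableTopology X] (hp : 0 < p)
    {g : X → ℝ≥0∞} (hgm : Measurable g) (hg : LocallyPIntegrable p μ g) :
    ∀ᶠ γ in aeCurve p μ hp, FiniteOn (fun t => g (γ.toFun t)) γ.length := by
  choose U hUo hxU hU using hg
  obtain ⟨s, hs, hcov⟩ := TopologicalSpace.countable_cover_nhds fun x => (hUo x).mem_nhds (hxU x)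
  have h1 : ∀ᶠ γ in aeCurve p μ hp, ∀ x ∈ s, γ.lineIntegral ((U x).indicator g) ≠ ∞ := by
    rw [eventually_countable_ball hs]
    intro x _
    refine mem_aeCurve.2 ⟨(U x).indicator g, hgm.indicator (hUo x).measurableSet, ?_,
      fun γ hγ => hγ⟩
    convert hU x using 1
    rw [← lintegral_indicator (hUo x).measurableSet]
    refine lintegral_congr fun y => ?_
    by_cases hy : y ∈ U x <;> simp [hy, hp]
  filter_upwards [h1] with γ hγ
  refine ⟨γ.aemeasurable_comp hgm, ?_⟩
  have hcpt : IsCompact (γ.toFun '' Icc 0 γ.length) := isCompact_Icc.image_of_continuousOn γ.continuousOn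
  obtain ⟨T, hTs, hTf, hT⟩ := hcpt.elim_finite_subcover_image (b := s) (c := U)
    (fun x _ => hUo x) (by rw [hcov]; exact subset_univ _)
  have hle : ∫⁻ t in Icc 0 γ.length, g (γ.toFun t) ≤
      ∫⁻ t in Icc 0 γ.length, ∑ x ∈ hTf.toFinset, (U x).indicator g (γ.toFun t) := by
    refine setLIntegral_mono' measurableSet_Icc fun t ht => ?_
    obtain ⟨x, hxT, hx⟩ := mem_iUnion₂.1 (hT ⟨t, ht, rfl⟩)
    calc g (γ.toFun t) = (U x).indicator g (γ.toFun t) := by simp [hx]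
      _ ≤ _ := Finset.single_le_sum (f := fun x => (U x).indicator g (γ.toFun t))
        (fun _ _ => zero_le) (hTf.mem_toFinset.2 hxT)
  refine ne_top_of_le_ne_top ?_ hle
  rw [lintegral_finsetSum' _ fun x _ =>
    γ.aemeasurable_comp (hgm.indicator (hUo x).measurableSet)]
  exact ENNReal.sum_ne_top.2 fun x hx => hγ x (hTs (hTf.mem_toFinset.1 hx))

end

/-! ### Calculus of weak upper gradients and existence of a minimal one -/

section

variable {X : Type*} [MetricSpace X] [MeasurableSpace X] {p : ℝ} {μ : Measure X}

/-- `g` is a locally `p`-integrable `p`-weak upper gradient of `u`. -/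
def IsLocGradient (p : ℝ) (μ : Measure X) (u : X → ℝ) (g : X → ℝ≥0∞) : Prop :=
  IsWeakUpperGradient p μ u g ∧ LocallyPIntegrable p μ g

theorem LocallyPIntegrable.mono (hp : 0 < p) {g h : X → ℝ≥0∞} (hg : LocallyPIntegrable p μ g)
    (hle : ∀ x, h x ≤ g x) : LocallyPIntegrable p μ h := fun x =>
  let ⟨U, hU, hx, hi⟩ := hg x
  ⟨U, hU, hx, (lintegral_mono fun y => ENNReal.rpow_le_rpow (hle y) hp.le).trans_lt hi⟩

theorem LocallyPIntegrable.max {g h : X → ℝ≥0∞} (hgm : Measurable g)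
    (hg : LocallyPIntegrable p μ g) (hh : LocallyPIntegrable p μ h) :
    LocallyPIntegrable p μ fun x => max (g x) (h x) := fun x => by
  obtain ⟨U, hU, hxU, hiU⟩ := hg x
  obtain ⟨V, hV, hxV, hiV⟩ := hh x
  refine ⟨U ∩ V, hU.inter hV, ⟨hxU, hxV⟩, ?_⟩
  refine lt_of_le_of_lt (lintegral_mono (g := fun y => g y ^ p + h y ^ p) fun y => ?_) ?_
  · rcases max_choice (g y) (h y) with e | e <;> simp [e]
  · rw [lintegral_add_left (hgm.pow_const p)]
    exact ENNReal.add_lt_top.2 ⟨(lintegral_mono_set inter_subset_left).trans_lt hiU,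
      (lintegral_mono_set inter_subset_right).trans_lt hiV⟩

theorem LocallyPIntegrable.const_mul (hp : 0 < p) {g : X → ℝ≥0∞} (hgm : Measurable g)
    (hg : LocallyPIntegrable p μ g) (c : ℝ≥0) : LocallyPIntegrable p μ fun x => c * g x := fun x => by
  obtain ⟨U, hU, hxU, hiU⟩ := hg x
  refine ⟨U, hU, hxU, ?_⟩
  simp_rw [ENNReal.mul_rpow_of_nonneg _ _ hp.le]
  rw [lintegral_const_mul _ (hgm.pow_const p)]
  exact ENNReal.mul_lt_top (ENNReal.rpow_lt_top_of_nonneg hp.le ENNReal.coe_ne_top) hiU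

theorem LocallyPIntegrable.add (hp : 0 < p) {g h : X → ℝ≥0∞} (hgm : Measurable g)
    (hhm : Measurable h) (hg : LocallyPIntegrable p μ g) (hh : LocallyPIntegrable p μ h) :
    LocallyPIntegrable p μ fun x => g x + h x := by
  refine ((hg.max hgm hh).const_mul hp (hgm.max hhm) 2).mono hp fun x => ?_
  rw [ENNReal.coe_ofNat, two_mul]
  exact add_le_add (le_max_left _ _) (le_max_right _ _)

theorem locallyPIntegrable_of_lintegral_lt_top {g : X → ℝ≥0∞} (hg : ∫⁻ x, g x ^ p ∂μ < ∞) :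
    LocallyPIntegrable p μ g :=
  fun _ => ⟨univ, isOpen_univ, mem_univ _, by simpa using hg⟩

theorem locallyPIntegrable_const (hp : 0 < p) [IsLocallyFiniteMeasure μ] (c : ℝ≥0) :
    LocallyPIntegrable p μ fun _ : X => (c : ℝ≥0∞) := fun x => by
  obtain ⟨U, hxU, hU, hi⟩ := μ.exists_isOpen_measure_lt_top x
  refine ⟨U, hU, hxU, ?_⟩
  rw [setLIntegral_const]
  exact ENNReal.mul_lt_top (ENNReal.rpow_lt_top_of_nonneg hp.le ENNReal.coe_ne_top) hi

theorem measurable_minGrad (u : X → ℝ) : Measurable (minGrad p μ u) := by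
  unfold minGrad
  split_ifs with h
  · exact h.choose_spec.1.1
  · exact measurable_const

theorem MemD.exists_isLocGradient {u : X → ℝ} (hu : MemD p μ u) : ∃ g, IsLocGradient p μ u g :=
  let ⟨g, h1, h2⟩ := hu.2
  ⟨g, h1, locallyPIntegrable_of_lintegral_lt_top h2⟩

theorem isLocGradient_of_lipschitz (hp : 0 < p) [IsLocallyFiniteMeasure μ] {u : X → ℝ} {K : ℝ≥0}
    (hu : LipschitzWith K u) : IsLocGradient p μ u fun _ => (K : ℝ≥0∞) := by
  refine ⟨(isWeakUpperGradient_iff hp).2 ⟨measurable_const, .of_forall fun γ s t hs hst ht => ?_⟩,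
    locallyPIntegrable_const hp K⟩
  rw [setLIntegral_const, Real.volume_Icc]
  exact (hu _ _).trans (by gcongr; exact γ.edist_le hs hst ht)

variable [BorelSpace X] [SecondCountableTopology X]

theorem IsLocGradient.eventually (hp : 0 < p) {u : X → ℝ} {g : X → ℝ≥0∞}
    (h : IsLocGradient p μ u g) : ∀ᶠ γ in aeCurve p μ hp,
      Dominates (fun t => u (γ.toFun t)) (fun t => g (γ.toFun t)) γ.length ∧
      FiniteOn (fun t => g (γ.toFun t)) γ.length :=
  ((isWeakUpperGradient_iff hp).1 h.1).2.and (h.2.finiteOn hp h.1.1)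

/-- Weak upper gradients may be glued along countable covers by arbitrary sets. -/
theorem isWeakUpperGradient_glue (hp : 0 < p) {ι : Type*} [Countable ι] {u : X → ℝ}
    {g : X → ℝ≥0∞} (hgm : Measurable g) {u' : ι → X → ℝ} {g' : ι → X → ℝ≥0∞} {A : ι → Set X}
    (h : ∀ n, IsLocGradient p μ (u' n) (g' n)) (hA : ∀ x, ∃ n, x ∈ A n)
    (hu : ∀ n, EqOn u (u' n) (A n)) (hg : ∀ n, ∀ x ∈ A n, g' n x ≤ g x)
    (hK : ∀ K : Set X, IsCompact K → ∃ n, EqOn u (u' n) K) : IsWeakUpperGradient p μ u g := by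
  refine (isWeakUpperGradient_iff hp).2 ⟨hgm, ?_⟩
  filter_upwards [eventually_countable_forall.2 fun n => (h n).eventually hp] with γ hγ
  -- On the compact image of the curve `u` is one of the `u' n`, which makes it absolutely
  -- continuous along the curve.
  obtain ⟨n, hn⟩ := hK _ (isCompact_Icc.image_of_continuousOn γ.continuousOn)
  have hd : Dominates (fun t => u (γ.toFun t)) (fun t => g' n (γ.toFun t)) γ.length := by
    intro s t hs hst ht
    have := (hγ n).1 s t hs hst ht
    have h1 := hn ⟨s, ⟨hs, hst.trans ht⟩, rfl⟩
    have h2 := hn ⟨t, ⟨hs.trans hst, ht⟩, rfl⟩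
    simpa only [h1, h2] using this
  exact hd.glue γ.length_nonneg (hγ n).2 (fun n => (hγ n).1) (fun n => (hγ n).2)
    (A := fun n => {t | γ.toFun t ∈ A n}) (fun t _ => mem_iUnion.2 (hA (γ.toFun t)))
    (fun n t ht _ => hu n ht) fun n t ht => hg n _ ht

-- Gluing along `A` and its complement. This is the locality of gradients; with `v = u` it shows
-- that gradients of one function are closed under minima.
open Classical in
theorem IsLocGradient.piecewise (hp : 0 < p) {u v : X → ℝ} {g h : X → ℝ≥0∞}
    (hu : IsLocGradient p μ u g) (hv : IsLocGradient p μ v h) {A : Set X} (hA : MeasurableSet A)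
    (huv : EqOn u v A) : IsLocGradient p μ u (A.piecewise h g) := by
  refine ⟨?_, (hv.2.max hv.1.1 hu.2).mono hp fun x => ?_⟩
  · refine isWeakUpperGradient_glue hp (hv.1.1.piecewise hA hu.1.1)
      (u' := fun b : Bool => if b then v else u) (g' := fun b => if b then h else g)
      (A := fun b => if b then A else Aᶜ) ?_ ?_ ?_ ?_ ?_
    · rintro (_ | _) <;> simpa
    · intro x
      by_cases hx : x ∈ A
      · exact ⟨true, by simpa⟩
      · exact ⟨false, by simpa⟩
    · rintro (_ | _)
      · simpa using eqOn_refl u Aᶜ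
      · simpa using huv
    · rintro (_ | _) x hx
      · have hx : x ∉ A := by simpa using hx
        simp [hx]
      · have hx : x ∈ A := by simpa using hx
        simp [hx]
    · exact fun K _ => ⟨false, by simpa using eqOn_refl u K⟩
  · by_cases hx : x ∈ A <;> simp [hx]

theorem IsLocGradient.min (hp : 0 < p) {u : X → ℝ} {g h : X → ℝ≥0∞}
    (hg : IsLocGradient p μ u g) (hh : IsLocGradient p μ u h) :
    IsLocGradient p μ u fun x => min (g x) (h x) := by
  classical
  convert hg.piecewise hp hh (measurableSet_lt hh.1.1 hg.1.1) (eqOn_refl _ _) using 1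
  ext x
  by_cases hx : h x < g x
  · simp [hx, hx.le]
  · simp [hx, not_lt.1 hx]

theorem IsLocGradient.of_edist_le_add (hp : 0 < p) {u v w : X → ℝ} {g h : X → ℝ≥0∞}
    (hv : IsLocGradient p μ v g) (hw : IsLocGradient p μ w h)
    (hle : ∀ x y, edist (u x) (u y) ≤ edist (v x) (v y) + edist (w x) (w y)) :
    IsLocGradient p μ u fun x => g x + h x := by
  refine ⟨(isWeakUpperGradient_iff hp).2 ⟨hv.1.1.add hw.1.1, ?_⟩, hv.2.add hp hv.1.1 hw.1.1 hw.2⟩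
  filter_upwards [hv.eventually hp, hw.eventually hp] with γ h1 h2 s t hs hst ht
  rw [lintegral_add_left' ((γ.aemeasurable_comp hv.1.1).mono_measure
    (Measure.restrict_mono (Icc_subset_Icc hs ht) le_rfl))]
  exact (hle _ _).trans (add_le_add (h1.1 s t hs hst ht) (h2.1 s t hs hst ht))

theorem IsLocGradient.of_edist_le_mul (hp : 0 < p) {u v : X → ℝ} {g : X → ℝ≥0∞}
    (hv : IsLocGradient p μ v g) (c : ℝ≥0) (hle : ∀ x y, edist (u x) (u y) ≤ c * edist (v x) (v y)) :
    IsLocGradient p μ u fun x => c * g x := by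
  refine ⟨(isWeakUpperGradient_iff hp).2 ⟨hv.1.1.const_mul _, ?_⟩, hv.2.const_mul hp hv.1.1 c⟩
  filter_upwards [hv.eventually hp] with γ h1 s t hs hst ht
  refine (hle _ _).trans (le_trans ?_ (lintegral_const_mul_le _ _))
  gcongr
  exact h1.1 s t hs hst ht

theorem IsLocGradient.of_edist_le (hp : 0 < p) {u v : X → ℝ} {g : X → ℝ≥0∞}
    (hv : IsLocGradient p μ v g) (hle : ∀ x y, edist (u x) (u y) ≤ edist (v x) (v y)) :
    IsLocGradient p μ u g := by
  simpa using hv.of_edist_le_mul hp 1 (by simpa using hle)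

theorem IsLocGradient.of_local (hp : 0 < p) {u v : X → ℝ} {g : X → ℝ≥0∞} (hu : Continuous u)
    (hv : IsLocGradient p μ v g)
    (hle : ∀ x, ∀ᶠ y in 𝓝 x, dist (u x) (u y) ≤ dist (v x) (v y)) : IsLocGradient p μ u g := by
  refine ⟨(isWeakUpperGradient_iff hp).2 ⟨hv.1.1, ?_⟩, hv.2⟩
  filter_upwards [hv.eventually hp] with γ h1
  refine h1.1.of_local γ.length_nonneg h1.2 (hu.comp_continuousOn γ.continuousOn) fun t ht => ?_
  exact (γ.continuousOn t ht).eventually (hle (γ.toFun t))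

/-- Along almost every curve `g 0` has finite integral, so the integrals of the decreasing sequence
converge to that of the infimum. -/
theorem isLocGradient_iInf (hp : 0 < p) {u : X → ℝ} {g : ℕ → X → ℝ≥0∞} (hanti : Antitone g)
    (hg : ∀ n, IsLocGradient p μ u (g n)) : IsLocGradient p μ u fun x => ⨅ n, g n x := by
  refine ⟨(isWeakUpperGradient_iff hp).2 ⟨Measurable.iInf fun n => (hg n).1.1, ?_⟩,
    (hg 0).2.mono hp fun x => iInf_le _ 0⟩
  filter_upwards [eventually_countable_forall.2 fun n => (hg n).eventually hp]
    with γ hγ s t hs hst ht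
  have hsub : Icc s t ⊆ Icc 0 γ.length := Icc_subset_Icc hs ht
  rw [lintegral_iInf' (fun n => ((hγ n).2.1.mono_measure (Measure.restrict_mono hsub le_rfl)))
    (ae_of_all _ fun r m n hmn => hanti hmn _)
    (ne_top_of_le_ne_top (hγ 0).2.2 (lintegral_mono_set hsub))]
  exact le_iInf fun n => (hγ n).1 s t hs hst ht

/-- Gradients are closed under minima and decreasing limits, so some `G` maximizes the functional
Φ(g) = ∫ (1 + g)⁻¹ dm, which is finite because `m` is a finite measure with μ ≪ m. Replacing `G` by
its minimum with another gradient cannot raise Φ, hence changes nothing almost everywhere. -/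
theorem exists_isMinWeakUpperGradient (hp : 0 < p) [SFinite μ] {u : X → ℝ}
    (hu : ∃ g, IsLocGradient p μ u g) : ∃ g, IsMinWeakUpperGradient p μ u g := by
  obtain ⟨m, hm, hμm, -⟩ := exists_isFiniteMeasure_absolutelyContinuous μ
  set Φ : (X → ℝ≥0∞) → ℝ≥0∞ := fun g => ∫⁻ x, (1 + g x)⁻¹ ∂m with hΦ
  have hΦmono : ∀ {g h : X → ℝ≥0∞}, (∀ x, g x ≤ h x) → Φ h ≤ Φ g := fun hgh =>
    lintegral_mono fun x => ENNReal.inv_le_inv.2 (by gcongr; exact hgh x)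
  have hΦfin : ∀ g, Φ g ≠ ∞ := fun g => by
    refine ne_top_of_le_ne_top (measure_ne_top m univ) ?_
    rw [← lintegral_one]
    exact lintegral_mono fun x => ENNReal.inv_le_one.2 le_self_add
  obtain ⟨y, -, hy, hyS⟩ := exists_seq_tendsto_sSup (S := Φ '' {g | IsLocGradient p μ u g})
    (Nonempty.image _ hu) (OrderTop.bddAbove _)
  choose g hg hgy using hyS
  let h : ℕ → X → ℝ≥0∞ := fun n => Nat.rec (g 0) (fun k f x => min (f x) (g (k + 1) x)) n
  have hh : ∀ n, IsLocGradient p μ u (h n) := by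
    intro n
    induction n with
    | zero => exact hg 0
    | succ k ih => exact ih.min hp (hg (k + 1))
  have hanti : Antitone h := antitone_nat_of_succ_le fun n x => min_le_left _ _
  have hle : ∀ n x, h n x ≤ g n x := by
    rintro (_ | n) x
    · exact le_rfl
    · exact min_le_right _ _
  have hinf := isLocGradient_iInf hp hanti hh
  set G : X → ℝ≥0∞ := fun x => ⨅ n, h n x
  refine ⟨G, hinf.1, hinf.2, fun g' hg' hg'i => hμm ?_⟩
  have hk := hinf.min hp ⟨hg', hg'i⟩
  have hmax : Φ (fun x => min (G x) (g' x)) ≤ Φ G := by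
    refine (le_sSup (mem_image_of_mem Φ hk)).trans (le_of_tendsto' hy fun n => ?_)
    rw [← hgy n]
    exact hΦmono fun x => (iInf_le _ n).trans (hle n x)
  have hae := ae_eq_of_ae_le_of_lintegral_le
    (ae_of_all m fun x => ENNReal.inv_le_inv.2
      (show 1 + min (G x) (g' x) ≤ 1 + G x by gcongr; exact min_le_left _ _))
    (hΦfin G) (hk.1.1.const_add 1).inv.aemeasurable hmax
  filter_upwards [hae] with x hx
  have h1 : 1 + G x = 1 + min (G x) (g' x) := inv_injective hx
  rw [ENNReal.add_right_inj ENNReal.one_ne_top] at h1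
  rw [h1]
  exact min_le_right _ _

theorem isMinWeakUpperGradient_minGrad (hp : 0 < p) [SFinite μ] {u : X → ℝ}
    (hu : ∃ g, IsLocGradient p μ u g) : IsMinWeakUpperGradient p μ u (minGrad p μ u) := by
  have h := exists_isMinWeakUpperGradient hp hu
  rw [minGrad, dif_pos h]
  exact h.choose_spec

theorem isLocGradient_minGrad (hp : 0 < p) [SFinite μ] {u : X → ℝ}
    (hu : ∃ g, IsLocGradient p μ u g) : IsLocGradient p μ u (minGrad p μ u) :=
  ⟨(isMinWeakUpperGradient_minGrad hp hu).1, (isMinWeakUpperGradient_minGrad hp hu).2.1⟩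

theorem IsLocGradient.minGrad_le (hp : 0 < p) [SFinite μ] {u : X → ℝ} {g : X → ℝ≥0∞}
    (hu : IsLocGradient p μ u g) : ∀ᵐ x ∂μ, minGrad p μ u x ≤ g x :=
  (isMinWeakUpperGradient_minGrad hp ⟨g, hu⟩).2.2 g hu.1 hu.2

theorem IsLocGradient.minGrad_le_of_eqOn (hp : 0 < p) [SFinite μ] {u v : X → ℝ} {g : X → ℝ≥0∞}
    (hv : IsLocGradient p μ v g) (hu : ∃ g, IsLocGradient p μ u g) {A : Set X}
    (hA : MeasurableSet A) (huv : EqOn u v A) : ∀ᵐ x ∂μ, x ∈ A → minGrad p μ u x ≤ g x := by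
  classical
  obtain ⟨g₀, hg₀⟩ := hu
  filter_upwards [(hg₀.piecewise hp hv hA huv).minGrad_le hp] with x hx hxA
  simpa [hxA] using hx

end

/-! ### The sawtooth function -/

/-- The piecewise affine function of slopes `±1` that vanishes on `aℤ` and has the constant
value `a / 2` on `aℤ + a / 2`. -/
noncomputable def sawtooth (a x : ℝ) : ℝ := a * |x / a - round (x / a)|

theorem sawtooth_nonneg {a : ℝ} (ha : 0 ≤ a) (x : ℝ) : 0 ≤ sawtooth a x :=
  mul_nonneg ha (abs_nonneg _)

theorem sawtooth_le {a : ℝ} (ha : 0 ≤ a) (x : ℝ) : sawtooth a x ≤ a := by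
  have := abs_sub_round (x / a)
  exact mul_le_of_le_one_right ha (by linarith)

theorem dist_sawtooth_le {a : ℝ} (ha : 0 < a) (x y : ℝ) :
    dist (sawtooth a x) (sawtooth a y) ≤ dist x y := by
  have key : ∀ x y : ℝ, sawtooth a x - sawtooth a y ≤ |x - y| := fun x y => by
    have h1 := round_le (x / a) (round (y / a))
    have h2 := abs_sub_le (x / a) (y / a) (round (y / a))
    have h3 : a * |x / a - y / a| = |x - y| := by
      rw [← sub_div, abs_div, abs_of_pos ha]; field_simp
    simp only [sawtooth]
    nlinarith
  rw [Real.dist_eq, Real.dist_eq, abs_sub_le_iff]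
  exact ⟨key x y, by rw [abs_sub_comm]; exact key y x⟩

theorem abs_sub_round_eq_of_mem_Icc {x : ℝ} {k : ℤ} (h : x ∈ Icc (k : ℝ) (k + 1)) :
    |x - round x| = min (x - k) (k + 1 - x) := by
  rw [abs_sub_round_eq_min]
  rcases h.2.lt_or_eq with h2 | h2
  · rw [Int.fract_eq_iff.2 ⟨sub_nonneg.2 h.1, by linarith, k, by ring⟩]
    congr 1
    ring
  · have : Int.fract x = 0 := Int.fract_eq_iff.2 ⟨le_rfl, one_pos, k + 1, by push_cast; linarith⟩
    rw [this, h2]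
    simp

/-- Immediately on either side of `x` the function is affine with slope 1 or -1. As one of the two
points compared is `x` itself, this remains true at the kinks. -/
theorem eventually_abs_sub_le_abs_sub_round (x : ℝ) :
    ∀ᶠ y in 𝓝 x, |x - y| ≤ dist (|x - round x|) (|y - round y|) := by
  simp only [Real.dist_eq]
  set k := ⌊x⌋
  have hk1 : (k : ℝ) ≤ x := Int.floor_le x
  have hk2 : x < k + 1 := Int.lt_floor_add_one x
  rw [abs_sub_round_eq_of_mem_Icc (x := x) (k := k) ⟨hk1, hk2.le⟩]
  -- The cases are the lower kink at an integer, then a fractional part below, equal to (upper kink)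
  -- or above 1/2.
  rcases hk1.eq_or_lt with h0 | h0
  · have hnb : Ioo (x - 1 / 2) (x + 1 / 2) ∈ 𝓝 x := Ioo_mem_nhds (by linarith) (by linarith)
    filter_upwards [hnb] with y hy
    rcases le_total x y with hxy | hxy
    · rw [abs_sub_round_eq_of_mem_Icc (x := y) (k := k) ⟨by linarith, by linarith [hy.2]⟩]
      rw [min_eq_left (by linarith), min_eq_left (by linarith [hy.2])]
      exact le_of_eq (by congr 1; ring)
    · rw [abs_sub_round_eq_of_mem_Icc (x := y) (k := k - 1)
        ⟨by push_cast; linarith [hy.1], by push_cast; linarith⟩]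
      push_cast
      rw [min_eq_left (by linarith), min_eq_right (by linarith [hy.1]), abs_sub_comm]
      exact le_of_eq (by congr 1; linarith)
  · have hnb : Ioo (k : ℝ) (k + 1) ∈ 𝓝 x := Ioo_mem_nhds h0 hk2
    rcases lt_trichotomy (x - k) (1 / 2) with h | h | h
    · filter_upwards [hnb, Iio_mem_nhds (show x < k + 1 / 2 by linarith)] with y hy hy'
      rw [abs_sub_round_eq_of_mem_Icc (x := y) (k := k) (Ioo_subset_Icc_self hy)]
      rw [min_eq_left (by linarith), min_eq_left (by linarith [mem_Iio.1 hy'])]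
      exact le_of_eq (by congr 1; ring)
    · filter_upwards [hnb] with y hy
      rw [abs_sub_round_eq_of_mem_Icc (x := y) (k := k) (Ioo_subset_Icc_self hy)]
      rw [min_eq_left (by linarith)]
      rcases le_total x y with hxy | hxy
      · rw [min_eq_right (by linarith), abs_sub_comm]
        exact le_of_eq (by congr 1; linarith)
      · rw [min_eq_left (by linarith)]
        exact le_of_eq (by congr 1; ring)
    · filter_upwards [hnb, Ioi_mem_nhds (show (k : ℝ) + 1 / 2 < x by linarith)] with y hy hy'
      rw [abs_sub_round_eq_of_mem_Icc (x := y) (k := k) (Ioo_subset_Icc_self hy)]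
      rw [min_eq_right (by linarith), min_eq_right (by linarith [mem_Ioi.1 hy']), abs_sub_comm]
      exact le_of_eq (by congr 1; ring)

theorem eventually_dist_le_dist_sawtooth {a : ℝ} (ha : 0 < a) (x : ℝ) :
    ∀ᶠ y in 𝓝 x, dist x y ≤ dist (sawtooth a x) (sawtooth a y) := by
  have hc : Tendsto (fun y => y / a) (𝓝 x) (𝓝 (x / a)) := tendsto_id.div_const a
  filter_upwards [hc.eventually (eventually_abs_sub_le_abs_sub_round (x / a))] with y hy
  rw [Real.dist_eq, Real.dist_eq, sawtooth, sawtooth, ← mul_sub, abs_mul, abs_of_pos ha]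
  rw [Real.dist_eq, ← sub_div, abs_div, abs_of_pos ha, div_le_iff₀ ha] at hy
  linarith

theorem edist_min_le_add (a b c d : ℝ) :
    edist (min a b) (min c d) ≤ edist a c + edist b d := by
  have h : dist (min a b) (min c d) ≤ dist a c + dist b d := by
    simp only [Real.dist_eq]
    exact (abs_min_sub_min_le_max a b c d).trans
      (max_le_add_of_nonneg (abs_nonneg _) (abs_nonneg _))
  simp only [edist_dist]
  rw [← ENNReal.ofReal_add dist_nonneg dist_nonneg]
  exact ENNReal.ofReal_le_ofReal h

/-! ### Lipschitz functions and cutoffs -/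

section

variable {Y : Type*} [MetricSpace Y]

theorem IsLip.continuous {u : Y → ℝ} (hu : IsLip u) : Continuous u := hu.choose_spec.continuous

theorem isLip_const (c : ℝ) : IsLip fun _ : Y => c := ⟨0, LipschitzWith.const c⟩

theorem IsLip.add {u v : Y → ℝ} (hu : IsLip u) (hv : IsLip v) : IsLip fun y => u y + v y :=
  let ⟨K, hK⟩ := hu
  let ⟨M, hM⟩ := hv
  ⟨K + M, hK.add hM⟩

theorem isLip_min {u v : Y → ℝ} (hu : IsLip u) (hv : IsLip v) : IsLip fun y => min (u y) (v y) :=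
  let ⟨K, hK⟩ := hu
  let ⟨M, hM⟩ := hv
  ⟨max K M, hK.min hM⟩

theorem isLip_max {u v : Y → ℝ} (hu : IsLip u) (hv : IsLip v) : IsLip fun y => max (u y) (v y) :=
  let ⟨K, hK⟩ := hu
  let ⟨M, hM⟩ := hv
  ⟨max K M, hK.max hM⟩

theorem IsLip.const_mul {u : Y → ℝ} (hu : IsLip u) (c : ℝ) : IsLip fun y => c * u y :=
  let ⟨K, hK⟩ := hu
  ⟨‖c‖₊ * K, (lipschitzWith_smul c).comp hK⟩

theorem IsLip.sawtooth {u : Y → ℝ} (hu : IsLip u) {a : ℝ} (ha : 0 < a) :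
    IsLip fun y => sawtooth a (u y) :=
  let ⟨K, hK⟩ := hu
  ⟨1 * K, (LipschitzWith.mk_one (dist_sawtooth_le ha)).comp hK⟩

variable [MeasurableSpace Y] {p : ℝ} {ν : Measure Y}

theorem IsMetricMeasure.isLocallyFiniteMeasure (hν : IsMetricMeasure ν) :
    IsLocallyFiniteMeasure ν :=
  ⟨fun x => ⟨Metric.ball x 1, Metric.ball_mem_nhds x one_pos,
    hν.finite_of_bounded _ Metric.isBounded_ball⟩⟩

theorem IsLip.exists_isLocGradient (hp : 0 < p) [IsLocallyFiniteMeasure ν] {u : Y → ℝ}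
    (hu : IsLip u) : ∃ g, IsLocGradient p ν u g :=
  let ⟨_, hK⟩ := hu
  ⟨_, isLocGradient_of_lipschitz hp hK⟩

variable [BorelSpace Y] [SecondCountableTopology Y]

/-- A gradient of a function may be taken to vanish on a Borel set where the function does. -/
theorem IsLocGradient.indicator (hp : 0 < p) [IsLocallyFiniteMeasure ν] {v : Y → ℝ}
    {g : Y → ℝ≥0∞} (hv : IsLocGradient p ν v g) {U : Set Y} (hU : MeasurableSet U)
    (h0 : ∀ y ∉ U, v y = 0) : IsLocGradient p ν v (U.indicator g) := by
  classical
  have hz : IsLocGradient p ν (fun _ : Y => (0 : ℝ)) fun _ => ((0 : ℝ≥0) : ℝ≥0∞) :=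
    isLocGradient_of_lipschitz hp (LipschitzWith.const 0)
  convert hv.piecewise hp hz hU.compl h0 using 1
  ext y
  by_cases hy : y ∈ U <;> simp [hy]

theorem memD_of_eqOn_zero (hp : 0 < p) [IsLocallyFiniteMeasure ν] {v : Y → ℝ} (hv : IsLip v)
    {U : Set Y} (hU : MeasurableSet U) (hνU : ν U < ∞) (h0 : ∀ y ∉ U, v y = 0) : MemD p ν v := by
  obtain ⟨K, hK⟩ := hv
  refine ⟨hK.continuous.measurable.aemeasurable, _,
    ((isLocGradient_of_lipschitz hp hK).indicator hp hU h0).1, ?_⟩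
  have : ∀ y, U.indicator (fun _ => (K : ℝ≥0∞)) y ^ p = U.indicator (fun _ => (K : ℝ≥0∞) ^ p) y :=
    fun y => by by_cases hy : y ∈ U <;> simp [hy, hp]
  simp_rw [this]
  rw [lintegral_indicator hU, setLIntegral_const]
  exact ENNReal.mul_lt_top (ENNReal.rpow_lt_top_of_nonneg hp.le ENNReal.coe_ne_top) hνU

/-- A Lipschitz function agrees on a ball with a Lipschitz function in `D^{1,p}`. -/
theorem IsLip.exists_memD_eqOn_ball (hp : 0 < p) (hν : IsMetricMeasure ν) {u : Y → ℝ}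
    (hu : IsLip u) (y₀ : Y) (R : ℝ) :
    ∃ v, IsLip v ∧ MemD p ν v ∧ EqOn u v (Metric.ball y₀ R) := by
  have := hν.isLocallyFiniteMeasure
  obtain ⟨K, hK⟩ := hu
  -- `M` bounds |u| on the ball, while `e` is at least `M` there and vanishes at distance more than
  -- `R + 1`. Truncating `u` between `-e` and `e` thus leaves it unchanged on the ball.
  set M : ℝ := |u y₀| + K * |R|
  have hM : 0 ≤ M := by positivity
  set e : Y → ℝ := fun y => M * max 0 (R + 1 + (-1) * dist y y₀)
  have he : IsLip e := by
    refine IsLip.const_mul (isLip_max (isLip_const 0) (IsLip.add (isLip_const _) ?_)) M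
    exact IsLip.const_mul ⟨1, LipschitzWith.dist_left y₀⟩ _
  have hv : IsLip fun y => max ((-1) * e y) (min (u y) (e y)) :=
    isLip_max (he.const_mul _) (isLip_min ⟨K, hK⟩ he)
  refine ⟨_, hv, memD_of_eqOn_zero hp hv (U := Metric.closedBall y₀ (R + 1))
    Metric.isClosed_closedBall.measurableSet
    (hν.finite_of_bounded _ Metric.isBounded_closedBall) ?_, ?_⟩
  · intro y hy
    have hy : R + 1 < dist y y₀ := by simpa using hy
    have : e y = 0 := by simp only [e]; rw [max_eq_left (by linarith), mul_zero]
    simp only [this]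
    simp
  · intro y hy
    have hy : dist y y₀ < R := hy
    have h1 : |u y| ≤ M := by
      have h2 := hK.dist_le_mul y y₀
      rw [Real.dist_eq] at h2
      have h3 : (K : ℝ) * dist y y₀ ≤ K * |R| := by
        gcongr; exact hy.le.trans (le_abs_self R)
      have h4 : |u y| ≤ |u y - u y₀| + |u y₀| := by
        simpa using abs_add_le (u y - u y₀) (u y₀)
      linarith
    have h5 : M ≤ e y := le_mul_of_one_le_right hM (le_max_of_le_right (by linarith))
    have h6 := abs_le.1 (h1.trans h5)
    simp only
    rw [min_eq_left h6.2, max_eq_right (by linarith [h6.1])]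

end

/-! ### Gradients of compositions -/

section

variable {X Y : Type*} [MetricSpace X] [MeasurableSpace X] [BorelSpace X]
  [SecondCountableTopology X] [MetricSpace Y] [MeasurableSpace Y] [BorelSpace Y]
  [SecondCountableTopology Y] {p q : ℝ} {μ : Measure X} {ν : Measure Y} {φ : X → Y}

/-- The operator acts on D^{1,p} only, but `u` agrees on each ball about `φ x₀` with a function of
that space. The resulting gradients are glued along the disjointed preimages of the balls; on the
preimage of any one ball only finitely many of them occur. -/
theorem exists_isLocGradient_comp (hp : 0 < p) (hq : 0 < q) (hν : IsMetricMeasure ν)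
    (hφ : Continuous φ) (hop : ∀ v : Y → ℝ, MemD p ν v → IsLip v → MemD q μ (v ∘ φ))
    {u : Y → ℝ} (hu : IsLip u) : ∃ g, IsLocGradient q μ (u ∘ φ) g := by
  obtain hX | ⟨⟨x₀⟩⟩ := isEmpty_or_nonempty X
  · refine ⟨0, ⟨measurable_const, ?_⟩, fun x => isEmptyElim x⟩
    rw [modulus_eq_zero_iff hq]
    refine mem_of_superset univ_mem fun γ _ => (hX.false (γ.toFun 0)).elim
  set y₀ := φ x₀
  choose v hv hvD hvu using fun n : ℕ => hu.exists_memD_eqOn_ball hp hν y₀ (n + 1)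
  choose g hg using fun n => (hop (v n) (hvD n) (hv n)).exists_isLocGradient
  set A : ℕ → Set X := fun n => φ ⁻¹' Metric.ball y₀ (n + 1)
  have hAo : ∀ n, IsOpen (A n) := fun n => Metric.isOpen_ball.preimage hφ
  have hAu : ∀ n, EqOn (u ∘ φ) (v n ∘ φ) (A n) := fun n x hx => hvu n hx
  have hAx : ∀ x, ∃ n, x ∈ A n := fun x => by
    obtain ⟨n, hn⟩ := exists_nat_ge (dist (φ x) y₀)
    exact ⟨n, show dist (φ x) y₀ < n + 1 by linarith⟩
  set G : X → ℝ≥0∞ := fun x => ∑' n, (disjointed A n).indicator (g n) x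
  have hGm : Measurable G := Measurable.tsum fun n =>
    (hg n).1.1.indicator (MeasurableSet.disjointed (fun n => (hAo n).measurableSet) n)
  refine ⟨G, isWeakUpperGradient_glue hq hGm (A := disjointed A) hg ?_ ?_ ?_ ?_, ?_⟩
  · intro x
    have : x ∈ ⋃ n, disjointed A n := by rw [iUnion_disjointed]; exact mem_iUnion.2 (hAx x)
    exact mem_iUnion.1 this
  · exact fun n => (hAu n).mono (disjointed_subset A n)
  · intro n x hx
    calc g n x = (disjointed A n).indicator (g n) x := by simp [hx]
      _ ≤ G x := ENNReal.le_tsum n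
  · intro K hK
    obtain ⟨R, hR⟩ := (hK.image hφ).isBounded.subset_ball y₀
    obtain ⟨n, hn⟩ := exists_nat_ge R
    refine ⟨n, (hAu n).mono fun x hx => ?_⟩
    exact Metric.ball_subset_ball (by linarith) (hR ⟨x, hx, rfl⟩)
  · have hsum : ∀ n : ℕ, LocallyPIntegrable q μ fun x => ∑ k ∈ Finset.range n, g k x := by
      intro n
      induction n with
      | zero =>
        exact locallyPIntegrable_of_lintegral_lt_top (by simp [hq])
      | succ n ih =>
        simp_rw [Finset.sum_range_succ]
        exact ih.add hq (Finset.measurable_sum _ fun k _ => (hg k).1.1) (hg n).1.1 (hg n).2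
    intro x
    obtain ⟨n, hn⟩ := hAx x
    obtain ⟨U, hU, hxU, hi⟩ := hsum (n + 1) x
    refine ⟨U ∩ A n, hU.inter (hAo n), ⟨hxU, hn⟩, ?_⟩
    refine lt_of_le_of_lt (le_trans ?_ (lintegral_mono_set (s := U ∩ A n) inter_subset_left)) hi
    refine setLIntegral_mono' (hU.inter (hAo n)).measurableSet fun y hy => ?_
    refine ENNReal.rpow_le_rpow ?_ hq.le
    have hG : G y = ∑ k ∈ Finset.range (n + 1), (disjointed A k).indicator (g k) y := by
      refine tsum_eq_sum fun k hk => indicator_of_notMem (fun hyk => ?_) _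
      have hnk : n < k := by simpa using hk
      rw [disjointed_apply, Finset.sup_eq_iSup, sdiff_eq, mem_inter_iff, mem_compl_iff] at hyk
      exact hyk.2 (mem_iUnion₂.2 ⟨n, Finset.mem_Iio.2 hnk, hy.2⟩)
    rw [hG]
    exact Finset.sum_le_sum fun k _ => indicator_le_self' (fun _ _ => zero_le) y

end

/-! ### Localization and gluing of Lipschitz functions -/

section

variable {Y : Type*} [MetricSpace Y] [MeasurableSpace Y] [BorelSpace Y]
  [SecondCountableTopology Y] {p : ℝ} {ν : Measure Y}

theorem lintegral_minGrad_lt_top (hp : 0 < p) (hν : IsMetricMeasure ν) {u : Y → ℝ} (hu : IsLip u)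
    {B : Set Y} (hB : Bornology.IsBounded B) : ∫⁻ y in B, minGrad p ν u y ^ p ∂ν < ∞ := by
  have := hν.isLocallyFiniteMeasure
  obtain ⟨L, hL⟩ := hu
  calc ∫⁻ y in B, minGrad p ν u y ^ p ∂ν ≤ ∫⁻ _ in B, (L : ℝ≥0∞) ^ p ∂ν := by
        refine lintegral_mono_ae (ae_restrict_of_ae ?_)
        filter_upwards [(isLocGradient_of_lipschitz hp hL).minGrad_le hp] with y hy
        exact ENNReal.rpow_le_rpow hy hp.le
    _ < ∞ := by
        rw [setLIntegral_const]
        exact ENNReal.mul_lt_top (ENNReal.rpow_lt_top_of_nonneg hp.le ENNReal.coe_ne_top)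
          (hν.finite_of_bounded B hB)

/-- On a set of finite measure, the energy of a Lipschitz function changes little if a small
constant is added to its gradient. -/
theorem tendsto_lintegral_minGrad_add (hp : 0 < p) (hν : IsMetricMeasure ν) {u : Y → ℝ}
    (hu : IsLip u) {U : Set Y} (hU : Bornology.IsBounded U) :
    Tendsto (fun n : ℕ => ∫⁻ y in U, (minGrad p ν u y + (((n : ℝ≥0) + 1)⁻¹ : ℝ≥0)) ^ p ∂ν) atTop
      (𝓝 (∫⁻ y in U, minGrad p ν u y ^ p ∂ν)) := by
  have := hν.isLocallyFiniteMeasure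
  obtain ⟨L, hL⟩ := hu
  refine tendsto_lintegral_of_dominated_convergence (fun _ => ((L : ℝ≥0∞) + 1) ^ p)
    (fun n => ((measurable_minGrad u).add_const _).pow_const p) (fun n => ?_) ?_ ?_
  · refine ae_restrict_of_ae ?_
    filter_upwards [(isLocGradient_of_lipschitz hp hL).minGrad_le hp] with y hy
    refine ENNReal.rpow_le_rpow (add_le_add hy ?_) hp.le
    have : ((n : ℝ≥0) + 1)⁻¹ ≤ 1 := inv_le_one_of_one_le₀ (by simp)
    exact_mod_cast this
  · rw [setLIntegral_const]
    exact ENNReal.mul_ne_top (ENNReal.rpow_ne_top_of_nonneg hp.le (by simp))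
      (hν.finite_of_bounded U hU).ne
  · refine ae_of_all _ fun y => ?_
    have h0 : Tendsto (fun n : ℕ => ((((n : ℝ≥0) + 1)⁻¹ : ℝ≥0) : ℝ≥0∞)) atTop (𝓝 0) := by
      rw [← ENNReal.coe_zero, ENNReal.tendsto_coe]
      have := tendsto_one_div_add_atTop_nhds_zero_nat (𝕜 := ℝ≥0)
      simpa using this
    have h1 := (tendsto_const_nhds (x := minGrad p ν u y)).add h0
    rw [add_zero] at h1
    exact (ENNReal.continuous_rpow_const.tendsto _).comp h1

/-- A Lipschitz function can be replaced by one that has the same slopes on a given closed bounded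
set, is supported near that set, and has almost no energy off the set. -/
theorem exists_localization (hp : 0 < p) (hν : IsMetricMeasure ν) {u : Y → ℝ} (hu : IsLip u)
    {K : Set Y} (hK : IsClosed K) (hKb : Bornology.IsBounded K) {r : ℝ} (hr : 0 < r) {ε : ℝ≥0∞}
    (hε : ε ≠ 0) :
    ∃ (v : Y → ℝ) (g : Y → ℝ≥0∞) (a : ℝ), IsLip v ∧ MemD p ν v ∧ IsLocGradient p ν v g ∧
      (∀ y ∉ Metric.thickening r K, v y = 0 ∧ g y = 0) ∧ 0 < a ∧
      (∀ y ∈ K, v y = sawtooth a (u y)) ∧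
      ∫⁻ y, g y ^ p ∂ν ≤ ∫⁻ y in K, minGrad p ν u y ^ p ∂ν + ε := by
  have := hν.isLocallyFiniteMeasure
  have hε2 : ε / 2 ≠ 0 := (ENNReal.half_pos hε).ne'
  set m : Measure Y := ν.withDensity fun y => minGrad p ν u y ^ p
  have hm : ∀ B, MeasurableSet B → m B = ∫⁻ y in B, minGrad p ν u y ^ p ∂ν := fun B hB =>
    withDensity_apply _ hB
  have hmK : m K ≠ ∞ := by
    rw [hm K hK.measurableSet]; exact (lintegral_minGrad_lt_top hp hν hu hKb).ne
  -- The closed thickenings decrease to `K` and have finite energy, so a thin one exceeds the energy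
  -- of `K` by less than ε/2.
  have hth := tendsto_measure_cthickening_of_isClosed (μ := m) (s := K) ⟨1, one_pos, by
    rw [hm _ Metric.isClosed_cthickening.measurableSet]
    exact (lintegral_minGrad_lt_top hp hν hu hKb.cthickening).ne⟩ hK
  have hlt : m K < m K + ε / 2 := ENNReal.lt_add_right hmK hε2
  obtain ⟨s, hs, hs0, hsr⟩ := (((hth.mono_left (nhdsWithin_le_nhds (s := Ioi 0))).eventually
    (gt_mem_nhds hlt)).and (Ioo_mem_nhdsGT hr)).exists
  have hs : m (Metric.cthickening s K) < m K + ε / 2 := hs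
  set U := Metric.thickening s K
  have hUm : MeasurableSet U := Metric.isOpen_thickening.measurableSet
  have hUb : Bornology.IsBounded U := hKb.thickening
  have hUE : ∫⁻ y in U, minGrad p ν u y ^ p ∂ν < ∫⁻ y in K, minGrad p ν u y ^ p ∂ν + ε / 2 := by
    rw [← hm U hUm, ← hm K hK.measurableSet]
    exact (measure_mono (Metric.thickening_subset_cthickening s K)).trans_lt hs
  have hUfin := (lintegral_minGrad_lt_top hp hν hu hUb).ne
  obtain ⟨n, hn⟩ := ((tendsto_lintegral_minGrad_add hp hν hu hUb).eventually
    (gt_mem_nhds (ENNReal.lt_add_right hUfin hε2))).exists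
  -- The slope `c` granted to the cutoff: adding it to the gradient on `U` costs less than ε/2. The
  -- amplitude `c * s` is the height that a cutoff of slope `c` descends over distance `s`.
  set c : ℝ≥0 := ((n : ℝ≥0) + 1)⁻¹
  have hc : 0 < c := by positivity
  set a : ℝ := c * s
  have ha : 0 < a := by positivity
  set θ : Y → ℝ := fun y => a * (thickenedIndicator hs0 K y : ℝ)
  have hθ : LipschitzWith c θ := by
    refine LipschitzWith.of_dist_le_mul fun x y => ?_
    have h1 := (lipschitzWith_thickenedIndicator hs0 K).dist_le_mul x y
    rw [NNReal.dist_eq] at h1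
    rw [Real.dist_eq, ← mul_sub, abs_mul, abs_of_pos ha]
    refine (mul_le_mul_of_nonneg_left h1 ha.le).trans (le_of_eq ?_)
    rw [NNReal.coe_inv, Real.coe_toNNReal s hs0.le]
    simp only [a]
    field_simp
  set v : Y → ℝ := fun y => min (sawtooth a (u y)) (θ y)
  have hv : IsLip v := isLip_min (hu.sawtooth ha) ⟨c, hθ⟩
  have hvU : ∀ y ∉ U, v y = 0 := fun y hy => by
    simp only [v, θ]
    rw [thickenedIndicator_zero hs0 K hy]
    simp [sawtooth_nonneg ha.le]
  have hug := isLocGradient_minGrad hp (hu.exists_isLocGradient (ν := ν) hp)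
  have hsg : IsLocGradient p ν (fun y => sawtooth a (u y)) (minGrad p ν u) :=
    hug.of_edist_le hp fun x y => by
      rw [edist_dist, edist_dist]
      exact ENNReal.ofReal_le_ofReal (dist_sawtooth_le ha _ _)
  have hvg : IsLocGradient p ν v fun y => minGrad p ν u y + c :=
    hsg.of_edist_le_add hp (isLocGradient_of_lipschitz hp hθ) fun x y => edist_min_le_add _ _ _ _
  refine ⟨v, _, a, hv, memD_of_eqOn_zero hp hv hUm (hν.finite_of_bounded U hUb) hvU,
    hvg.indicator hp hUm hvU, ?_, ha, ?_, ?_⟩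
  · intro y hy
    have hyU : y ∉ U := fun h => hy (Metric.thickening_mono hsr.le K h)
    exact ⟨hvU y hyU, indicator_of_notMem hyU _⟩
  · intro y hy
    simp only [v, θ]
    rw [thickenedIndicator_one hs0 K hy, NNReal.coe_one, mul_one, min_eq_left (sawtooth_le ha.le _)]
  · have hind : ∀ y, U.indicator (fun y => minGrad p ν u y + c) y ^ p
        = U.indicator (fun y => (minGrad p ν u y + c) ^ p) y :=
      fun y => by by_cases hy : y ∈ U <;> simp [hy, hp]
    simp_rw [hind]
    rw [lintegral_indicator hUm]
    refine hn.le.trans ?_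
    calc ∫⁻ y in U, minGrad p ν u y ^ p ∂ν + ε / 2
        ≤ (∫⁻ y in K, minGrad p ν u y ^ p ∂ν + ε / 2) + ε / 2 := by gcongr
      _ = _ := by rw [add_assoc, ENNReal.add_halves]

end

section

variable {X : Type*} [MetricSpace X] [MeasurableSpace X] [BorelSpace X]
  [SecondCountableTopology X] {q : ℝ} {μ : Measure X}

/-- On `A` the sawtooth of `f` inherits the gradient of `w` by locality. Near each point `f`
oscillates no more than its sawtooth, so the gradient passes on to `f`. -/
theorem ae_minGrad_le_of_eq_sawtooth (hq : 0 < q) [SFinite μ] {f w : X → ℝ} (hfc : Continuous f)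
    (hf : ∃ g, IsLocGradient q μ f g) (hw : ∃ g, IsLocGradient q μ w g) {A : Set X}
    (hA : MeasurableSet A) {a : ℝ} (ha : 0 < a) (hfw : ∀ x ∈ A, w x = sawtooth a (f x)) :
    ∀ᵐ x ∂μ, x ∈ A → minGrad q μ f x ≤ minGrad q μ w x := by
  classical
  obtain ⟨g, hg⟩ := hf
  have hsg : IsLocGradient q μ (fun x => sawtooth a (f x)) g := hg.of_edist_le hq fun x y => by
    rw [edist_dist, edist_dist]
    exact ENNReal.ofReal_le_ofReal (dist_sawtooth_le ha _ _)
  have hp := hsg.piecewise hq (isLocGradient_minGrad hq hw) hA fun x hx => (hfw x hx).symm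
  have hfp := hp.of_local hq hfc fun x =>
    (hfc.tendsto x).eventually (eventually_dist_le_dist_sawtooth ha (f x))
  filter_upwards [hfp.minGrad_le hq] with x hx hxA
  simpa [hxA] using hx

end

section

variable {X Y : Type*} [MetricSpace X] [MeasurableSpace X] [BorelSpace X]
  [SecondCountableTopology X] [MetricSpace Y] [MeasurableSpace Y] [BorelSpace Y]
  [SecondCountableTopology Y] {p q : ℝ} {μ : Measure X} {ν : Measure Y} {φ : X → Y}

/-- Two Lipschitz functions, considered on closed sets with disjoint thickenings, can be replaced
by a single one without increasing the total energy much and without decreasing the energy of the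
compositions. -/
theorem exists_glued (hp : 0 < p) (hq : 0 < q) [SFinite μ] (hν : IsMetricMeasure ν)
    (hφ : Continuous φ) (hop : ∀ v : Y → ℝ, MemD p ν v → IsLip v → MemD q μ (v ∘ φ))
    {u₁ u₂ : Y → ℝ} (hu₁ : IsLip u₁) (hu₂ : IsLip u₂) {K₁ K₂ : Set Y} (hK₁ : IsClosed K₁)
    (hK₂ : IsClosed K₂) (hb₁ : Bornology.IsBounded K₁) (hb₂ : Bornology.IsBounded K₂) {r : ℝ}
    (hr : 0 < r) (hdisj : Disjoint (Metric.thickening r K₁) (Metric.thickening r K₂)) {ε : ℝ≥0∞}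
    (hε : ε ≠ 0) (hε' : ε ≠ ∞) :
    ∃ v : Y → ℝ, IsLip v ∧ MemD p ν v ∧
      ∫⁻ y, minGrad p ν v y ^ p ∂ν ≤
        ∫⁻ y in K₁, minGrad p ν u₁ y ^ p ∂ν + ∫⁻ y in K₂, minGrad p ν u₂ y ^ p ∂ν + ε ∧
      ∫⁻ x in φ ⁻¹' K₁, minGrad q μ (u₁ ∘ φ) x ^ q ∂μ ≤
        ∫⁻ x in φ ⁻¹' K₁, minGrad q μ (v ∘ φ) x ^ q ∂μ ∧
      ∫⁻ x in φ ⁻¹' K₂, minGrad q μ (u₂ ∘ φ) x ^ q ∂μ ≤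
        ∫⁻ x in φ ⁻¹' K₂, minGrad q μ (v ∘ φ) x ^ q ∂μ := by
  have := hν.isLocallyFiniteMeasure
  have hε2 : ε / 2 ≠ 0 := (ENNReal.half_pos hε).ne'
  obtain ⟨v₁, g₁, a₁, hv₁, hD₁, hg₁, h0₁, ha₁, hs₁, hE₁⟩ :=
    exists_localization hp hν hu₁ hK₁ hb₁ hr hε2
  obtain ⟨v₂, g₂, a₂, hv₂, hD₂, hg₂, h0₂, ha₂, hs₂, hE₂⟩ :=
    exists_localization hp hν hu₂ hK₂ hb₂ hr hε2
  have hv : IsLip fun y => v₁ y + v₂ y := hv₁.add hv₂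
  have hvg : IsLocGradient p ν (fun y => v₁ y + v₂ y) fun y => g₁ y + g₂ y :=
    hg₁.of_edist_le_add hp hg₂ fun x y => edist_add_add_le _ _ _ _
  -- The gradients have disjoint supports, so their `p`-energies add without a constant.
  have hz : ∀ y, g₁ y = 0 ∨ g₂ y = 0 := fun y => by
    by_cases hy : y ∈ Metric.thickening r K₁
    · exact Or.inr (h0₂ y (disjoint_left.1 hdisj hy)).2
    · exact Or.inl (h0₁ y hy).2
  have hint : ∫⁻ y, (g₁ y + g₂ y) ^ p ∂ν = ∫⁻ y, g₁ y ^ p ∂ν + ∫⁻ y, g₂ y ^ p ∂ν := by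
    rw [← lintegral_add_left (hg₁.1.1.pow_const p)]
    refine lintegral_congr fun y => ?_
    rcases hz y with h | h <;> simp [h, hp]
  have hE : ∫⁻ y, (g₁ y + g₂ y) ^ p ∂ν ≤ ∫⁻ y in K₁, minGrad p ν u₁ y ^ p ∂ν +
      ∫⁻ y in K₂, minGrad p ν u₂ y ^ p ∂ν + ε := by
    rw [hint]
    refine (add_le_add hE₁ hE₂).trans (le_of_eq ?_)
    rw [add_add_add_comm, ENNReal.add_halves]
  have hfin : ∫⁻ y, (g₁ y + g₂ y) ^ p ∂ν < ∞ :=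
    hE.trans_lt (ENNReal.add_lt_top.2 ⟨ENNReal.add_lt_top.2 ⟨lintegral_minGrad_lt_top hp hν hu₁ hb₁,
      lintegral_minGrad_lt_top hp hν hu₂ hb₂⟩, hε'.lt_top⟩)
  have hD : MemD p ν fun y => v₁ y + v₂ y :=
    ⟨hv.continuous.measurable.aemeasurable, _, hvg.1, hfin⟩
  have hmin := hvg.minGrad_le hp
  have hw := (hop _ hD hv).exists_isLocGradient
  have hcmp : ∀ {u : Y → ℝ} {K : Set Y} {a : ℝ}, IsLip u → IsClosed K → 0 < a →
      (∀ y ∈ K, v₁ y + v₂ y = sawtooth a (u y)) →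
      ∫⁻ x in φ ⁻¹' K, minGrad q μ (u ∘ φ) x ^ q ∂μ ≤
        ∫⁻ x in φ ⁻¹' K, minGrad q μ ((fun y => v₁ y + v₂ y) ∘ φ) x ^ q ∂μ := by
    intro u K a hu hK ha h
    refine lintegral_mono_ae ((ae_restrict_iff' (hK.preimage hφ).measurableSet).2 ?_)
    filter_upwards [ae_minGrad_le_of_eq_sawtooth hq (hu.continuous.comp hφ)
      (exists_isLocGradient_comp hp hq hν hφ hop hu) hw (hK.preimage hφ).measurableSet ha
      fun x hx => h _ hx] with x hx hxK
    exact ENNReal.rpow_le_rpow (hx hxK) hq.le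
  refine ⟨_, hv, hD, (lintegral_mono_ae ?_).trans hE, hcmp hu₁ hK₁ ha₁ fun y hy => ?_,
    hcmp hu₂ hK₂ ha₂ fun y hy => ?_⟩
  · filter_upwards [hmin] with y hy
    exact ENNReal.rpow_le_rpow hy hp.le
  · rw [hs₁ y hy, (h0₂ y (disjoint_left.1 hdisj (Metric.self_subset_thickening hr K₁ hy))).1,
      add_zero]
  · rw [hs₂ y hy, (h0₁ y (disjoint_right.1 hdisj (Metric.self_subset_thickening hr K₂ hy))).1,
      zero_add]

end

/-! ### Separation and inner approximation by closed sets -/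

section

variable {Y : Type*} [MetricSpace Y]

theorem disjoint_thickening_diff (K₁ K₂ : Set Y) {δ : ℝ} :
    Disjoint (Metric.thickening (δ / 2) (K₁ \ Metric.thickening δ K₂))
      (Metric.thickening (δ / 2) K₂) := by
  refine disjoint_left.2 fun x h1 h2 => ?_
  obtain ⟨a, ha, hxa⟩ := Metric.mem_thickening_iff.1 h1
  obtain ⟨b, hb, hxb⟩ := Metric.mem_thickening_iff.1 h2
  refine ha.2 (Metric.mem_thickening_iff.2 ⟨b, hb, ?_⟩)
  have := dist_triangle_left a b x
  linarith

variable [MeasurableSpace Y]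

/-- Each point of `K₁` has positive distance from the closed set `K₂`; the rest is continuity from
below. -/
theorem measure_le_iSup_diff_thickening {m : Measure Y} {K₁ K₂ : Set Y} (hK₂ : IsClosed K₂)
    (h : Disjoint K₁ K₂) :
    m K₁ ≤ ⨆ n : ℕ, m (K₁ \ Metric.thickening (1 / ((n : ℝ) + 1)) K₂) := by
  have hmono : Monotone fun n : ℕ => K₁ \ Metric.thickening (1 / ((n : ℝ) + 1)) K₂ :=
    fun i j hij => sdiff_subset_sdiff_right
      (Metric.thickening_mono (one_div_le_one_div_of_le (by positivity) (by gcongr)) K₂)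
  rw [← hmono.measure_iUnion]
  refine measure_mono fun x hx => ?_
  have hx2 : x ∉ closure K₂ := by
    rw [hK₂.closure_eq]; exact disjoint_left.1 h hx
  rw [Metric.closure_eq_iInter_thickening] at hx2
  simp only [mem_iInter, not_forall] at hx2
  obtain ⟨δ, hδ, hxδ⟩ := hx2
  obtain ⟨n, hn⟩ := exists_nat_one_div_lt hδ
  exact mem_iUnion.2 ⟨n, hx, fun hmem => hxδ (Metric.thickening_mono hn.le K₂ hmem)⟩

variable [BorelSpace Y] [SecondCountableTopology Y]

theorem measure_le_iSup_isClosed_isBounded {m : Measure Y}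
    (hm : ∀ B : Set Y, Bornology.IsBounded B → m B < ∞) {B : Set Y} (hB : MeasurableSet B) :
    m B ≤ ⨆ (K : Set Y) (_ : K ⊆ B ∧ IsClosed K ∧ Bornology.IsBounded K), m K := by
  obtain hY | ⟨⟨y₀⟩⟩ := isEmpty_or_nonempty Y
  · simp [Set.eq_empty_of_isEmpty B]
  have : IsLocallyFiniteMeasure m :=
    ⟨fun x => ⟨Metric.ball x 1, Metric.ball_mem_nhds x one_pos, hm _ Metric.isBounded_ball⟩⟩
  refine le_of_forall_lt fun t ht => ?_
  have hmono : Monotone fun n : ℕ => B ∩ Metric.closedBall y₀ n := fun i j hij =>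
    inter_subset_inter_right B (Metric.closedBall_subset_closedBall (by exact_mod_cast hij))
  have hU : m B = ⨆ n : ℕ, m (B ∩ Metric.closedBall y₀ n) := by
    rw [← hmono.measure_iUnion, ← inter_iUnion, Metric.iUnion_closedBall_nat, inter_univ]
  rw [hU] at ht
  obtain ⟨n, hn⟩ := lt_iSup_iff.1 ht
  have hbd : Bornology.IsBounded (B ∩ Metric.closedBall y₀ n) :=
    Metric.isBounded_closedBall.subset inter_subset_right
  obtain ⟨K, hKB, hK, htK⟩ := (hB.inter Metric.isClosed_closedBall.measurableSet).exists_lt_isClosed_of_ne_top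
    (hm _ hbd).ne hn
  exact htK.trans_le (le_iSup₂_of_le K ⟨hKB.trans inter_subset_left, hK, hbd.subset hKB⟩ le_rfl)

end

/-! ### Homogeneity of the energies -/

section

variable {X : Type*} [MetricSpace X] [MeasurableSpace X] [BorelSpace X]
  [SecondCountableTopology X] {p : ℝ} {μ : Measure X}

theorem lintegral_minGrad_const_mul_le (hp : 0 < p) [SFinite μ] {u : X → ℝ}
    (hu : ∃ g, IsLocGradient p μ u g) (c : ℝ≥0) (B : Set X) :
    ∫⁻ x in B, minGrad p μ (fun x => c * u x) x ^ p ∂μ ≤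
      (c : ℝ≥0∞) ^ p * ∫⁻ x in B, minGrad p μ u x ^ p ∂μ := by
  rw [← lintegral_const_mul _ ((measurable_minGrad u).pow_const p)]
  refine lintegral_mono_ae (ae_restrict_of_ae ?_)
  have h := (isLocGradient_minGrad hp hu).of_edist_le_mul hp (u := fun x => c * u x) c
    fun x y => le_of_eq (by
      have := edist_smul₀ (c : ℝ) (u x) (u y)
      simpa [ENNReal.smul_def] using this)
  filter_upwards [h.minGrad_le hp] with x hx
  rw [← ENNReal.mul_rpow_of_nonneg _ _ hp.le]
  exact ENNReal.rpow_le_rpow hx hp.le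

/-- The upper bound, applied to `c * u` with the factor `c⁻¹`. -/
theorem le_lintegral_minGrad_const_mul (hp : 0 < p) [SFinite μ] {u : X → ℝ}
    (hu : ∃ g, IsLocGradient p μ u g) (c : ℝ≥0) (B : Set X) :
    (c : ℝ≥0∞) ^ p * ∫⁻ x in B, minGrad p μ u x ^ p ∂μ ≤
      ∫⁻ x in B, minGrad p μ (fun x => c * u x) x ^ p ∂μ := by
  rcases eq_or_ne c 0 with rfl | hc
  · simp [hp]
  obtain ⟨g, hg⟩ := hu
  have hcu : IsLocGradient p μ (fun x => c * u x) fun x => c * g x :=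
    hg.of_edist_le_mul hp c fun x y => le_of_eq (by
      have := edist_smul₀ (c : ℝ) (u x) (u y)
      simpa [ENNReal.smul_def] using this)
  have h := lintegral_minGrad_const_mul_le hp ⟨_, hcu⟩ c⁻¹ B
  have he : (fun x => ((c⁻¹ : ℝ≥0) : ℝ) * (c * u x)) = u := by
    ext x
    rw [NNReal.coe_inv, inv_mul_cancel_left₀ (by exact_mod_cast hc)]
  rw [he] at h
  refine (mul_le_mul_right h _).trans (le_of_eq ?_)
  rw [← mul_assoc, ← ENNReal.mul_rpow_of_nonneg _ _ hp.le, ← ENNReal.coe_mul, mul_inv_cancel₀ hc]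
  simp

end

/-! ### The energy inequality on disjoint Borel sets -/

section

variable {X Y : Type*} [MetricSpace X] [MeasurableSpace X] [BorelSpace X] [MetricSpace Y]
  [MeasurableSpace Y] [BorelSpace Y] {q : ℝ} {μ : Measure X} {φ : X → Y}

/-- The measure on `Y` with the values `∫_{φ⁻¹(B)} |∇_q (u ∘ φ)| ^ q dμ`. -/
noncomputable def compEnergy (q : ℝ) (μ : Measure X) (φ : X → Y) (u : Y → ℝ) : Measure Y :=
  (μ.withDensity fun x => minGrad q μ (u ∘ φ) x ^ q).map φ

theorem compEnergy_apply (hφ : Continuous φ) (u : Y → ℝ) {B : Set Y} (hB : MeasurableSet B) :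
    compEnergy q μ φ u B = ∫⁻ x in φ ⁻¹' B, minGrad q μ (u ∘ φ) x ^ q ∂μ := by
  rw [compEnergy, Measure.map_apply hφ.measurable hB, withDensity_apply _ (hφ.measurable hB)]

end

section

variable {X Y : Type*} [MetricSpace X] [MeasurableSpace X] [BorelSpace X]
  [SecondCountableTopology X] [MetricSpace Y] [MeasurableSpace Y] [BorelSpace Y]
  [SecondCountableTopology Y] {p q σ : ℝ} {μ : Measure X} {ν : Measure Y} {φ : X → Y}

theorem MemD.lintegral_minGrad_lt_top (hp : 0 < p) [SFinite ν] {v : Y → ℝ} (hv : MemD p ν v) :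
    ∫⁻ y, minGrad p ν v y ^ p ∂ν < ∞ := by
  obtain ⟨g, hg, hi⟩ := hv.2
  refine lt_of_le_of_lt (lintegral_mono_ae ?_) hi
  have h : IsLocGradient p ν v g := ⟨hg, locallyPIntegrable_of_lintegral_lt_top hi⟩
  filter_upwards [h.minGrad_le hp] with y hy
  exact ENNReal.rpow_le_rpow hy hp.le

theorem lintegral_minGrad_comp_lt_top (hp : 0 < p) (hq : 0 < q) [SFinite μ]
    (hν : IsMetricMeasure ν) (hφ : Continuous φ)
    (hop : ∀ v : Y → ℝ, MemD p ν v → IsLip v → MemD q μ (v ∘ φ)) {u : Y → ℝ} (hu : IsLip u)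
    {B : Set Y} (hB : Bornology.IsBounded B) :
    ∫⁻ x in φ ⁻¹' B, minGrad q μ (u ∘ φ) x ^ q ∂μ < ∞ := by
  obtain hX | ⟨⟨x₀⟩⟩ := isEmpty_or_nonempty X
  · simp [Measure.eq_zero_of_isEmpty μ]
  obtain ⟨R, hR⟩ := hB.subset_ball (φ x₀)
  obtain ⟨v, hv, hvD, huv⟩ := hu.exists_memD_eqOn_ball hp hν (φ x₀) R
  have hvφ := hop v hvD hv
  refine lt_of_le_of_lt ?_ (hvφ.lintegral_minGrad_lt_top hq)
  have hm : MeasurableSet (φ ⁻¹' Metric.ball (φ x₀) R) :=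
    (Metric.isOpen_ball.preimage hφ).measurableSet
  calc ∫⁻ x in φ ⁻¹' B, minGrad q μ (u ∘ φ) x ^ q ∂μ
      ≤ ∫⁻ x in φ ⁻¹' Metric.ball (φ x₀) R, minGrad q μ (u ∘ φ) x ^ q ∂μ :=
        lintegral_mono_set (preimage_mono hR)
    _ ≤ ∫⁻ x in φ ⁻¹' Metric.ball (φ x₀) R, minGrad q μ (v ∘ φ) x ^ q ∂μ := by
        refine lintegral_mono_ae ((ae_restrict_iff' hm).2 ?_)
        filter_upwards [(isLocGradient_minGrad hq hvφ.exists_isLocGradient).minGrad_le_of_eqOn hq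
          (exists_isLocGradient_comp hp hq hν hφ hop hu) hm fun x hx => huv hx] with x hx hxm
        exact ENNReal.rpow_le_rpow (hx hxm) hq.le
    _ ≤ _ := setLIntegral_le_lintegral _ _

/-- An energy inequality for Lipschitz functions in `D^{1,p}` implies one for pairs of Lipschitz
functions considered on disjoint Borel sets. -/
theorem compEnergy_add_le (hp : 0 < p) (hq : 0 < q) [SFinite μ] (hν : IsMetricMeasure ν)
    (hφ : Continuous φ) (hop : ∀ v : Y → ℝ, MemD p ν v → IsLip v → MemD q μ (v ∘ φ))
    {B B₁ B₂ : Set Y} (hB₁ : MeasurableSet B₁) (hB₂ : MeasurableSet B₂) (h₁ : B₁ ⊆ B)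
    (h₂ : B₂ ⊆ B) (hd : Disjoint B₁ B₂) {S : ℝ≥0∞} (hS : S ≠ ∞)
    (H : ∀ v : Y → ℝ, IsLip v → MemD p ν v →
      compEnergy q μ φ v B ≤ S * (∫⁻ y, minGrad p ν v y ^ p ∂ν) ^ (q / p))
    {u₁ u₂ : Y → ℝ} (hu₁ : IsLip u₁) (hu₂ : IsLip u₂) :
    compEnergy q μ φ u₁ B₁ + compEnergy q μ φ u₂ B₂ ≤
      S * (∫⁻ y in B₁, minGrad p ν u₁ y ^ p ∂ν + ∫⁻ y in B₂, minGrad p ν u₂ y ^ p ∂ν) ^ (q / p) := by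
  have hqp : 0 < q / p := div_pos hq hp
  have hbd : ∀ u : Y → ℝ, IsLip u → ∀ A : Set Y, Bornology.IsBounded A →
      compEnergy q μ φ u A < ∞ := fun u hu A hA => by
    refine (measure_mono subset_closure).trans_lt ?_
    rw [compEnergy_apply hφ u isClosed_closure.measurableSet]
    exact lintegral_minGrad_comp_lt_top hp hq hν hφ hop hu hA.closure
  have sep : ∀ (K₁ K₂ : Set Y) (r : ℝ), IsClosed K₁ → IsClosed K₂ → Bornology.IsBounded K₁ →
      Bornology.IsBounded K₂ → K₁ ⊆ B₁ → K₂ ⊆ B₂ → 0 < r →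
      Disjoint (Metric.thickening r K₁) (Metric.thickening r K₂) →
      compEnergy q μ φ u₁ K₁ + compEnergy q μ φ u₂ K₂ ≤ S * (∫⁻ y in B₁, minGrad p ν u₁ y ^ p ∂ν +
        ∫⁻ y in B₂, minGrad p ν u₂ y ^ p ∂ν) ^ (q / p) := by
    intro K₁ K₂ r hK₁ hK₂ hb₁ hb₂ hs₁ hs₂ hr hdis
    set E := ∫⁻ y in B₁, minGrad p ν u₁ y ^ p ∂ν + ∫⁻ y in B₂, minGrad p ν u₂ y ^ p ∂ν
    have hε : ∀ n : ℕ, compEnergy q μ φ u₁ K₁ + compEnergy q μ φ u₂ K₂ ≤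
        S * (E + ((n : ℝ≥0∞) + 1)⁻¹) ^ (q / p) := by
      intro n
      obtain ⟨v, hv, hvD, hE, hF₁, hF₂⟩ := exists_glued hp hq hν hφ hop hu₁ hu₂ hK₁ hK₂ hb₁ hb₂ hr
        hdis (ε := ((n : ℝ≥0∞) + 1)⁻¹) (by simp) (by simp)
      rw [← compEnergy_apply hφ _ hK₁.measurableSet, ← compEnergy_apply hφ _ hK₁.measurableSet] at hF₁
      rw [← compEnergy_apply hφ _ hK₂.measurableSet, ← compEnergy_apply hφ _ hK₂.measurableSet] at hF₂
      calc compEnergy q μ φ u₁ K₁ + compEnergy q μ φ u₂ K₂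
          ≤ compEnergy q μ φ v K₁ + compEnergy q μ φ v K₂ := add_le_add hF₁ hF₂
        _ = compEnergy q μ φ v (K₁ ∪ K₂) :=
            (measure_union (hd.mono hs₁ hs₂) hK₂.measurableSet).symm
        _ ≤ compEnergy q μ φ v B := measure_mono (union_subset (hs₁.trans h₁) (hs₂.trans h₂))
        _ ≤ S * (∫⁻ y, minGrad p ν v y ^ p ∂ν) ^ (q / p) := H v hv hvD
        _ ≤ _ := by
            gcongr
            refine hE.trans ?_
            gcongr
            exact add_le_add (lintegral_mono_set hs₁) (lintegral_mono_set hs₂)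
    refine ge_of_tendsto' (x := atTop) ?_ hε
    have h0 : Tendsto (fun n : ℕ => E + ((n : ℝ≥0∞) + 1)⁻¹) atTop (𝓝 (E + 0)) := by
      refine tendsto_const_nhds.add ?_
      have := (tendsto_add_atTop_iff_nat (f := fun n : ℕ => (n : ℝ≥0∞)⁻¹) 1).2
        ENNReal.tendsto_inv_nat_nhds_zero
      simpa using this
    rw [add_zero] at h0
    exact ENNReal.Tendsto.const_mul ((ENNReal.continuous_rpow_const.tendsto E).comp h0) (Or.inr hS)
  refine (add_le_add (measure_le_iSup_isClosed_isBounded (hbd u₁ hu₁) hB₁)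
    (measure_le_iSup_isClosed_isBounded (hbd u₂ hu₂) hB₂)).trans ?_
  refine ENNReal.biSup_add_biSup_le'
    (f := fun K => compEnergy q μ φ u₁ K) (g := fun K => compEnergy q μ φ u₂ K)
    ⟨∅, empty_subset _, isClosed_empty, Bornology.isBounded_empty⟩
    ⟨∅, empty_subset _, isClosed_empty, Bornology.isBounded_empty⟩ ?_
  rintro K₁ ⟨hs₁, hK₁, hb₁⟩ K₂ ⟨hs₂, hK₂, hb₂⟩
  -- Disjoint closed sets may have distance zero, so a thickening of `K₂` is removed from `K₁`
  -- before gluing.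
  refine (add_le_add_left (measure_le_iSup_diff_thickening hK₂ (hd.mono hs₁ hs₂)) _).trans ?_
  rw [ENNReal.iSup_add]
  refine iSup_le fun n => ?_
  exact sep _ K₂ (1 / ((n : ℝ) + 1) / 2) (hK₁.sdiff Metric.isOpen_thickening) hK₂
    (hb₁.subset sdiff_subset) hb₂ (sdiff_subset.trans hs₁) hs₂ (by positivity)
    (disjoint_thickening_diff K₁ K₂)

end

/-! ### The set function `Psi` and its additivity -/

section

variable {X Y : Type*} [MetricSpace X] [MeasurableSpace X] [BorelSpace X] [MetricSpace Y]
  [MeasurableSpace Y] [BorelSpace Y] {p q σ : ℝ} {μ : Measure X} {ν : Measure Y} {φ : X → Y}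

theorem Psi_eq_iSup (hσ : 0 < σ) (hφ : Continuous φ) {B : Set Y} (hB : MeasurableSet B) :
    Psi p q σ μ ν φ B = ⨆ (u : Y → ℝ) (_ : IsLip u ∧ ∫⁻ y in B, minGrad p ν u y ^ p ∂ν ≤ 1),
      compEnergy q μ φ u B ^ (σ / q) := by
  have h : ∀ x : ℝ≥0∞, x ^ σ = ENNReal.orderIsoRpow σ hσ x := fun _ => rfl
  rw [Psi, h]
  simp_rw [(ENNReal.orderIsoRpow σ hσ).map_iSup, iSup_and, ← h, ← ENNReal.rpow_mul,
    compEnergy_apply hφ _ hB, one_div_mul_eq_div]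

theorem compEnergy_rpow_le_Psi (hσ : 0 < σ) (hφ : Continuous φ) {B : Set Y} (hB : MeasurableSet B)
    {u : Y → ℝ} (hu : IsLip u) (h1 : ∫⁻ y in B, minGrad p ν u y ^ p ∂ν ≤ 1) :
    compEnergy q μ φ u B ^ (σ / q) ≤ Psi p q σ μ ν φ B := by
  rw [Psi_eq_iSup hσ hφ hB]
  exact le_iSup₂_of_le u ⟨hu, h1⟩ le_rfl

theorem InducesBoundedCompOp.exists_compEnergy_le (hq : 0 < q) (hφ : Continuous φ)
    (hop : InducesBoundedCompOp p q μ ν φ) : ∃ C : ℝ≥0, ∀ v : Y → ℝ, IsLip v → MemD p ν v →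
      compEnergy q μ φ v univ ≤ C * (∫⁻ y, minGrad p ν v y ^ p ∂ν) ^ (q / p) := by
  obtain ⟨C, hC⟩ := hop
  refine ⟨C ^ q, fun v hv hvD => ?_⟩
  have h := ENNReal.rpow_le_rpow (hC v hvD hv).2 hq.le
  rw [compEnergy_apply hφ _ MeasurableSet.univ, preimage_univ, Measure.restrict_univ]
  rw [ENNReal.mul_rpow_of_nonneg _ _ hq.le, ← ENNReal.rpow_mul, ← ENNReal.rpow_mul,
    one_div_mul_cancel hq.ne', ENNReal.rpow_one, one_div_mul_eq_div] at h
  rwa [ENNReal.coe_rpow_of_nonneg _ hq.le]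

end

section

variable {X Y : Type*} [MetricSpace X] [MeasurableSpace X] [BorelSpace X]
  [SecondCountableTopology X] [MetricSpace Y] [MeasurableSpace Y] [BorelSpace Y]
  [SecondCountableTopology Y] {p q σ : ℝ} {μ : Measure X} {ν : Measure Y} {φ : X → Y}

/-- The energy inequality of a bounded composition operator holds on all Borel sets. -/
theorem InducesBoundedCompOp.exists_compEnergy_le_of_measurableSet (hp : 0 < p) (hq : 0 < q)
    [SFinite μ] (hν : IsMetricMeasure ν) (hφ : Continuous φ)
    (hop : InducesBoundedCompOp p q μ ν φ) : ∃ C : ℝ≥0, ∀ u : Y → ℝ, IsLip u →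
      ∀ B : Set Y, MeasurableSet B →
        compEnergy q μ φ u B ≤ C * (∫⁻ y in B, minGrad p ν u y ^ p ∂ν) ^ (q / p) := by
  obtain ⟨C, hC⟩ := hop.exists_compEnergy_le hq hφ
  obtain ⟨_, hop'⟩ := hop
  refine ⟨C, fun u hu B hB => ?_⟩
  -- The case `B₂ = ∅`: localization passes from global functions in D^{1,p} to any Lipschitz
  -- function on `B`.
  simpa using compEnergy_add_le hp hq hν hφ (fun v hvD hv => (hop' v hvD hv).1) hB
    MeasurableSet.empty (subset_univ B) (empty_subset _) (disjoint_empty B) ENNReal.coe_ne_top hC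
    hu hu

theorem exists_Psi_le (hp : 0 < p) (hq : 0 < q) (hσ : 0 < σ) [SFinite μ] (hν : IsMetricMeasure ν)
    (hφ : Continuous φ) (hop : InducesBoundedCompOp p q μ ν φ) :
    ∃ C : ℝ≥0, ∀ B : Set Y, MeasurableSet B → Psi p q σ μ ν φ B ≤ C := by
  obtain ⟨C, hC⟩ := hop.exists_compEnergy_le_of_measurableSet hp hq hν hφ
  refine ⟨C ^ (σ / q), fun B hB => ?_⟩
  rw [Psi_eq_iSup hσ hφ hB, ENNReal.coe_rpow_of_nonneg _ (by positivity)]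
  refine iSup₂_le fun u ⟨hu, h1⟩ => ENNReal.rpow_le_rpow ((hC u hu B hB).trans ?_) (by positivity)
  exact mul_le_of_le_one_right' (ENNReal.rpow_le_one h1 (by positivity))

/-- The defining property of `Ψ`, in homogeneous form. -/
theorem compEnergy_le_Psi_mul (hp : 0 < p) (hq : 0 < q) (hσ : 0 < σ) [SFinite μ]
    (hν : IsMetricMeasure ν) (hφ : Continuous φ) (hop : InducesBoundedCompOp p q μ ν φ)
    {u : Y → ℝ} (hu : IsLip u) {B : Set Y} (hB : MeasurableSet B)
    (hE : ∫⁻ y in B, minGrad p ν u y ^ p ∂ν ≠ ∞) :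
    compEnergy q μ φ u B ≤
      Psi p q σ μ ν φ B ^ (q / σ) * (∫⁻ y in B, minGrad p ν u y ^ p ∂ν) ^ (q / p) := by
  have := hν.isLocallyFiniteMeasure
  set E := ∫⁻ y in B, minGrad p ν u y ^ p ∂ν with hEdef
  have hqp : 0 < q / p := div_pos hq hp
  -- Zero energy cannot be normalized; then the operator bound on Borel sets makes the left side
  -- vanish.
  rcases eq_or_ne E 0 with h0 | h0
  · obtain ⟨C, hC⟩ := hop.exists_compEnergy_le_of_measurableSet hp hq hν hφ
    have := hC u hu B hB
    rw [← hEdef, h0, ENNReal.zero_rpow_of_pos hqp, mul_zero] at this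
    exact this.trans zero_le
  have hE' : E ^ (-(1 / p)) ≠ ∞ := by
    simp [ENNReal.rpow_neg, ENNReal.rpow_eq_zero_iff, h0, hE]
  set c : ℝ≥0 := (E ^ (-(1 / p))).toNNReal
  have hc : (c : ℝ≥0∞) = E ^ (-(1 / p)) := ENNReal.coe_toNNReal hE'
  have hgY := hu.exists_isLocGradient (ν := ν) hp
  have hgX := exists_isLocGradient_comp hp hq hν hφ
    (fun v hvD hv => (hop.choose_spec v hvD hv).1) hu
  have h1 : ∫⁻ y in B, minGrad p ν (fun y => c * u y) y ^ p ∂ν ≤ 1 := by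
    refine (lintegral_minGrad_const_mul_le hp hgY c B).trans (le_of_eq ?_)
    rw [← hEdef, hc, ← ENNReal.rpow_mul, neg_mul, one_div_mul_cancel hp.ne', ENNReal.rpow_neg_one,
      ENNReal.inv_mul_cancel h0 hE]
  have h2 := compEnergy_rpow_le_Psi (q := q) (μ := μ) hσ hφ hB (hu.const_mul (c : ℝ)) h1
  have h3 := ENNReal.rpow_le_rpow h2 (show 0 ≤ q / σ by positivity)
  rw [← ENNReal.rpow_mul, show σ / q * (q / σ) = 1 by field_simp, ENNReal.rpow_one,
    compEnergy_apply hφ _ hB] at h3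
  have h4 := (le_lintegral_minGrad_const_mul hq hgX c (φ ⁻¹' B)).trans h3
  rw [← compEnergy_apply hφ _ hB, hc, ← ENNReal.rpow_mul] at h4
  have h5 : E ^ (-(1 / p) * q) * E ^ (q / p) = 1 := by
    rw [← ENNReal.rpow_add _ _ h0 hE]
    rw [show -(1 / p) * q + q / p = 0 by ring, ENNReal.rpow_zero]
  calc compEnergy q μ φ u B = E ^ (-(1 / p) * q) * compEnergy q μ φ u B * E ^ (q / p) := by
        rw [mul_right_comm, h5, one_mul]
    _ ≤ _ := by gcongr

/-- If b₁, b₂ are the values of two competitors, the scaled functions have energies at most bᵢ and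
composition energies at least bᵢ. With b = b₁ + b₂ and P = Ψ(B₁ ∪ B₂), gluing gives b ≤ P^(q/σ)
b^(q/p), that is, b ≤ P. -/
theorem Psi_add_le (hp : 0 < p) (hq : 0 < q) (hσ : 0 < σ) (hpqσ : q / σ + q / p = 1) [SFinite μ]
    (hν : IsMetricMeasure ν) (hφ : Continuous φ) (hop : InducesBoundedCompOp p q μ ν φ)
    {B₁ B₂ : Set Y} (hB₁ : MeasurableSet B₁) (hB₂ : MeasurableSet B₂) (hd : Disjoint B₁ B₂) :
    Psi p q σ μ ν φ B₁ + Psi p q σ μ ν φ B₂ ≤ Psi p q σ μ ν φ (B₁ ∪ B₂) := by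
  have := hν.isLocallyFiniteMeasure
  have hqp : 0 < q / p := div_pos hq hp
  have hqσ : 0 < q / σ := div_pos hq hσ
  have hop' : ∀ v : Y → ℝ, MemD p ν v → IsLip v → MemD q μ (v ∘ φ) :=
    fun v hvD hv => (hop.choose_spec v hvD hv).1
  obtain ⟨C, hC⟩ := exists_Psi_le hp hq hσ hν hφ hop
  have hfin : ∀ B : Set Y, MeasurableSet B → Psi p q σ μ ν φ B ≠ ∞ := fun B hB =>
    ne_top_of_le_ne_top ENNReal.coe_ne_top (hC B hB)
  set P := Psi p q σ μ ν φ (B₁ ∪ B₂)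
  have hB := hB₁.union hB₂
  have H : ∀ v : Y → ℝ, IsLip v → MemD p ν v → compEnergy q μ φ v (B₁ ∪ B₂) ≤
      P ^ (q / σ) * (∫⁻ y, minGrad p ν v y ^ p ∂ν) ^ (q / p) := fun v hv hvD => by
    have hle : ∫⁻ y in B₁ ∪ B₂, minGrad p ν v y ^ p ∂ν ≤ ∫⁻ y, minGrad p ν v y ^ p ∂ν :=
      setLIntegral_le_lintegral _ _
    refine (compEnergy_le_Psi_mul hp hq hσ hν hφ hop hv hB
      (ne_top_of_le_ne_top (hvD.lintegral_minGrad_lt_top hp).ne hle)).trans ?_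
    gcongr
  -- A competitor for `Ψ B` is rescaled so that both of its energies are governed by one number.
  have key : ∀ u : Y → ℝ, ∀ B : Set Y, MeasurableSet B →
      IsLip u ∧ ∫⁻ y in B, minGrad p ν u y ^ p ∂ν ≤ 1 →
      compEnergy q μ φ u B ^ (σ / q) ≠ ∞ ∧ ∃ w : Y → ℝ, IsLip w ∧
        compEnergy q μ φ u B ^ (σ / q) ≤ compEnergy q μ φ w B ∧
        ∫⁻ y in B, minGrad p ν w y ^ p ∂ν ≤ compEnergy q μ φ u B ^ (σ / q) := by
    rintro u B hB ⟨hu, hu1⟩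
    set a := compEnergy q μ φ u B
    set b := a ^ (σ / q)
    have hb : b ≠ ∞ := ne_top_of_le_ne_top (hfin B hB) (compEnergy_rpow_le_Psi hσ hφ hB hu hu1)
    refine ⟨hb, ?_⟩
    -- Scaling by b^(1/p) turns the energy into at most `b`, and the composition energy a = b^(q/σ)
    -- into at least b^(q/p + q/σ) = b.
    set c : ℝ≥0 := (b ^ (1 / p)).toNNReal
    have hc : (c : ℝ≥0∞) = b ^ (1 / p) :=
      ENNReal.coe_toNNReal (ENNReal.rpow_ne_top_of_nonneg (by positivity) hb)
    refine ⟨fun y => c * u y, hu.const_mul c, ?_, ?_⟩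
    · have h := le_lintegral_minGrad_const_mul hq
        (exists_isLocGradient_comp hp hq hν hφ hop' hu) c (φ ⁻¹' B)
      rw [← compEnergy_apply hφ _ hB, hc, ← ENNReal.rpow_mul, one_div_mul_eq_div] at h
      rw [compEnergy_apply hφ _ hB]
      refine le_trans (le_of_eq ?_) h
      have ha : a = b ^ (q / σ) := by
        rw [← ENNReal.rpow_mul, show σ / q * (q / σ) = 1 by field_simp, ENNReal.rpow_one]
      change b = b ^ (q / p) * a
      rw [ha, ← ENNReal.rpow_add_of_nonneg _ _ hqp.le hqσ.le, add_comm, hpqσ, ENNReal.rpow_one]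
    · refine (lintegral_minGrad_const_mul_le hp (hu.exists_isLocGradient hp) c B).trans ?_
      rw [hc, ← ENNReal.rpow_mul, one_div_mul_cancel hp.ne', ENNReal.rpow_one]
      exact mul_le_of_le_one_right' hu1
  rw [Psi_eq_iSup hσ hφ hB₁, Psi_eq_iSup hσ hφ hB₂]
  have hz : ∀ B : Set Y, ∃ u : Y → ℝ, IsLip u ∧ ∫⁻ y in B, minGrad p ν u y ^ p ∂ν ≤ 1 := by
    refine fun B => ⟨fun _ => 0, isLip_const 0, ?_⟩
    have h := (isLocGradient_of_lipschitz (μ := ν) hp (LipschitzWith.const (α := Y) (0 : ℝ))).minGrad_le hp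
    refine (lintegral_mono_ae (g := fun _ => 0) (ae_restrict_of_ae ?_)).trans (by simp)
    filter_upwards [h] with y hy
    have : minGrad p ν (fun _ : Y => (0 : ℝ)) y = 0 := le_antisymm (by simpa using hy) zero_le
    simp [this, hp]
  refine ENNReal.biSup_add_biSup_le' (f := fun u => compEnergy q μ φ u B₁ ^ (σ / q))
    (g := fun u => compEnergy q μ φ u B₂ ^ (σ / q)) (hz B₁) (hz B₂) ?_
  intro u₁ hu₁ u₂ hu₂
  obtain ⟨hb₁, w₁, hw₁, hF₁, hE₁⟩ := key u₁ B₁ hB₁ hu₁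
  obtain ⟨hb₂, w₂, hw₂, hF₂, hE₂⟩ := key u₂ B₂ hB₂ hu₂
  set b := compEnergy q μ φ u₁ B₁ ^ (σ / q) + compEnergy q μ φ u₂ B₂ ^ (σ / q)
  have hb : b ≠ ∞ := ENNReal.add_ne_top.2 ⟨hb₁, hb₂⟩
  have hmain : b ≤ P ^ (q / σ) * b ^ (q / p) :=
    (add_le_add hF₁ hF₂).trans ((compEnergy_add_le hp hq hν hφ hop' hB₁ hB₂ subset_union_left
      subset_union_right hd (ENNReal.rpow_ne_top_of_nonneg hqσ.le (hfin _ hB)) H hw₁ hw₂).trans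
      (by gcongr; exact add_le_add hE₁ hE₂))
  rcases eq_or_ne b 0 with h0 | h0
  · rw [h0]; exact zero_le
  have h1 : b ^ (q / σ) * b ^ (q / p) ≤ P ^ (q / σ) * b ^ (q / p) := by
    rwa [← ENNReal.rpow_add_of_nonneg _ _ hqσ.le hqp.le, hpqσ, ENNReal.rpow_one]
  rw [ENNReal.mul_le_mul_iff_left (by simp [ENNReal.rpow_eq_zero_iff, h0, hb])
    (ENNReal.rpow_ne_top_of_nonneg hqp.le hb)] at h1
  exact (ENNReal.rpow_le_rpow_iff hqσ).1 h1

/-- One inequality is Hölder's with the conjugate exponents σ/q and p/q, applied to the homogeneous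
bound on each piece; the other follows from superadditivity and the monotonicity it implies. -/
theorem Psi_iUnion (hp : 0 < p) (hq : 0 < q) (hσ : 0 < σ) (hpqσ : q / σ + q / p = 1) [SFinite μ]
    (hν : IsMetricMeasure ν) (hφ : Continuous φ) (hop : InducesBoundedCompOp p q μ ν φ)
    {B : ℕ → Set Y} (hB : ∀ n, MeasurableSet (B n)) (hd : Pairwise (Function.onFun Disjoint B)) :
    Psi p q σ μ ν φ (⋃ n, B n) = ∑' n, Psi p q σ μ ν φ (B n) := by
  have hqp : 0 < q / p := div_pos hq hp
  have hqσ : 0 < q / σ := div_pos hq hσ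
  have hU := MeasurableSet.iUnion hB
  refine le_antisymm ?_ ?_
  · rw [Psi_eq_iSup hσ hφ hU]
    refine iSup₂_le fun u ⟨hu, hu1⟩ => ?_
    set T := ∑' n, Psi p q σ μ ν φ (B n)
    have hEsum : ∑' n, ∫⁻ y in B n, minGrad p ν u y ^ p ∂ν ≤ 1 := by
      rwa [← lintegral_iUnion hB hd]
    have hE1 : ∀ n, ∫⁻ y in B n, minGrad p ν u y ^ p ∂ν ≠ ∞ := fun n =>
      ne_top_of_le_ne_top ENNReal.one_ne_top ((ENNReal.le_tsum n).trans hEsum)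
    have hconj : (σ / q).HolderConjugate (p / q) := by
      rw [Real.holderConjugate_iff]
      refine ⟨?_, by rw [inv_div, inv_div]; exact hpqσ⟩
      rw [one_lt_div hq]
      rw [← div_lt_one hσ]
      linarith
    have h : compEnergy q μ φ u (⋃ n, B n) ≤ T ^ (q / σ) := by
      rw [measure_iUnion hd hB, ENNReal.tsum_eq_iSup_sum]
      refine iSup_le fun s => ?_
      calc ∑ n ∈ s, compEnergy q μ φ u (B n)
          ≤ ∑ n ∈ s, Psi p q σ μ ν φ (B n) ^ (q / σ) *
              (∫⁻ y in B n, minGrad p ν u y ^ p ∂ν) ^ (q / p) :=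
            Finset.sum_le_sum fun n _ =>
              compEnergy_le_Psi_mul hp hq hσ hν hφ hop hu (hB n) (hE1 n)
        _ ≤ _ := ENNReal.inner_le_Lp_mul_Lq s _ _ hconj
        _ = (∑ n ∈ s, Psi p q σ μ ν φ (B n)) ^ (q / σ) *
              (∑ n ∈ s, ∫⁻ y in B n, minGrad p ν u y ^ p ∂ν) ^ (q / p) := by
            simp_rw [← ENNReal.rpow_mul, one_div_div]
            rw [show q / σ * (σ / q) = 1 by field_simp, show q / p * (p / q) = 1 by field_simp]
            simp_rw [ENNReal.rpow_one]
        _ ≤ T ^ (q / σ) * 1 := by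
            gcongr
            · exact ENNReal.sum_le_tsum s
            · exact ENNReal.rpow_le_one ((ENNReal.sum_le_tsum s).trans hEsum) hqp.le
        _ = T ^ (q / σ) := mul_one _
    calc compEnergy q μ φ u (⋃ n, B n) ^ (σ / q) ≤ (T ^ (q / σ)) ^ (σ / q) :=
          ENNReal.rpow_le_rpow h (by positivity)
      _ = T := by
          rw [← ENNReal.rpow_mul, show q / σ * (σ / q) = 1 by field_simp, ENNReal.rpow_one]
  · have hmono : ∀ {A A' : Set Y}, MeasurableSet A → MeasurableSet A' → A ⊆ A' →
        Psi p q σ μ ν φ A ≤ Psi p q σ μ ν φ A' := by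
      intro A A' hA hA' hAA'
      have h := Psi_add_le hp hq hσ hpqσ hν hφ hop hA (hA'.diff hA) disjoint_sdiff_right
      rw [union_sdiff_cancel hAA'] at h
      exact le_self_add.trans h
    have hfinite : ∀ n : ℕ, ∑ k ∈ Finset.range n, Psi p q σ μ ν φ (B k) ≤
        Psi p q σ μ ν φ (⋃ k ∈ Finset.range n, B k) := by
      intro n
      induction n with
      | zero => simp
      | succ n ih =>
        rw [Finset.sum_range_succ, Finset.range_add_one, Finset.set_biUnion_insert, union_comm]
        refine (add_le_add_left ih _).trans (Psi_add_le hp hq hσ hpqσ hν hφ hop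
          (Finset.measurableSet_biUnion _ fun k _ => hB k) (hB n) ?_)
        refine disjoint_iUnion₂_left.2 fun k hk => hd ?_
        exact (Finset.mem_range.1 hk).ne
    refine ENNReal.tsum_le_of_sum_range_le fun n => (hfinite n).trans ?_
    exact hmono (Finset.measurableSet_biUnion _ fun k _ => hB k) hU
      (iUnion₂_subset fun k _ => subset_iUnion B k)

end

end MetricSobolev

/-! ### The regular Borel measure -/

theorem mainTheorem4 {X Y : Type*}
    [MetricSpace X] [TopologicalSpace.SeparableSpace X] [MeasurableSpace X] [BorelSpace X]
    [MetricSpace Y] [TopologicalSpace.SeparableSpace Y] [MeasurableSpace Y] [BorelSpace Y]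
    (μ : Measure X) (ν : Measure Y)
    (hμ : MetricSobolev.IsMetricMeasure μ) (hν : MetricSobolev.IsMetricMeasure ν)
    (hμR : MetricSobolev.IsRadon μ)
    (p q σ : ℝ) (hq : 1 ≤ q) (hqp : q < p) (hσ : 1 / σ = 1 / q - 1 / p)
    (φ : X → Y) (hφ : Continuous φ)
    (hop : MetricSobolev.InducesBoundedCompOp p q μ ν φ) :
    ∃ Ψt : Measure Y,
      -- finite
      Ψt Set.univ < ∞ ∧
      -- Borel regular
      (∀ A : Set Y, ∃ B : Set Y, A ⊆ B ∧ MeasurableSet B ∧ Ψt B = Ψt A) ∧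
      -- given on all subsets by outer regularization over open sets
      (∀ A : Set Y, Ψt A =
        ⨅ (U : Set Y) (_ : IsOpen U) (_ : A ⊆ U), MetricSobolev.Psi p q σ μ ν φ U) ∧
      -- an extension of the set function defined on Borel sets
      (∀ B : Set Y, MeasurableSet B → Ψt B = MetricSobolev.Psi p q σ μ ν φ B) := by
  have : SecondCountableTopology X := UniformSpace.secondCountable_of_separable X
  have : SecondCountableTopology Y := UniformSpace.secondCountable_of_separable Y
  have := hμ.isLocallyFiniteMeasure
  have hq0 : 0 < q := by linarith
  have hp0 : 0 < p := by linarith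
  have hσ0 : 0 < σ := by
    rw [← one_div_pos, hσ]
    exact sub_pos.2 (one_div_lt_one_div_of_lt hq0 hqp)
  have hpqσ : q / σ + q / p = 1 := by
    rw [div_eq_mul_one_div q σ, hσ]
    field_simp
    ring
  have hempty : MetricSobolev.Psi p q σ μ ν φ ∅ = 0 := by
    rw [MetricSobolev.Psi_eq_iSup hσ0 hφ MeasurableSet.empty]
    simp [div_pos hσ0 hq0]
  let Ψt : Measure Y := Measure.ofMeasurable (fun B _ => MetricSobolev.Psi p q σ μ ν φ B) hempty
    fun B hB hd => MetricSobolev.Psi_iUnion hp0 hq0 hσ0 hpqσ hν hφ hop hB hd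
  have hΨ : ∀ B, MeasurableSet B → Ψt B = MetricSobolev.Psi p q σ μ ν φ B := fun B hB =>
    Measure.ofMeasurable_apply B hB
  have hfin : Ψt Set.univ < ∞ := by
    obtain ⟨C, hC⟩ := MetricSobolev.exists_Psi_le hp0 hq0 hσ0 hν hφ hop
    rw [hΨ _ MeasurableSet.univ]
    exact (hC _ MeasurableSet.univ).trans_lt ENNReal.coe_lt_top
  have : IsFiniteMeasure Ψt := ⟨hfin⟩
  refine ⟨Ψt, hfin, fun A => ?_, fun A => ?_, hΨ⟩
  · obtain ⟨B, hAB, hB, h⟩ := exists_measurable_superset Ψt A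
    exact ⟨B, hAB, hB, h⟩
  -- Outer regularity of the finite Borel measure `Ψt`; on open sets it is `Psi`.
  · rw [A.measure_eq_iInf_isOpen Ψt]
    refine iInf_congr fun U => ?_
    rw [iInf_comm]
    exact iInf_congr fun hU => iInf_congr fun _ => hΨ U hU.measurableSet
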